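/- Let $\Delta$ be an irreducible reduced crystallographic root system in a real vector space that is not simply laced (type $B_\ell, C_\ell, F_4$ or $G_2$), with simple roots $\alpha_i$ ($i\in I$), positive roots $\Delta^+$, root lattice $Q$ and Weyl group $W$ with length function $\ell$. For $\gamma\in\Delta$ let $c_\gamma$ be the squared length of $\gamma$ divided by that of a short root, and let $(\cdot,\cdot)$ be the $W$-invariant form with $(\alpha,\alpha)=2$ for short $\alpha$. Let $$\Delta_{\mathrm{af}}=\{\alpha+nc_\alpha\delta:\alpha\in\Delta,\ n\in\mathbb Z\},\qquad \Delta_{\mathrm{af}}^+=\Delta^+\sqcup\{\alpha+nc_\alpha\delta:\alpha\in\Delta,\ n>0\}$$ be the (positive) real roots of the twisted affine Lie algebra of dual untwisted type ($D_{\ell+1}^{(2)}$, $A_{2\ell-1}^{(2)}$, $E_6^{(2)}$, $D_4^{(3)}$ respectively) with underlying finite root system $\Delta$. Its Weyl group $W_{\mathrm{af}}=W\ltimes\{t_\xi:\xi\in Q\}$ is generated by the reflections $s_{\alpha+nc_\alpha\delta}=s_\alpha t_{n\alpha}$; it acts on $\operatorname{span}_{\mathbb R}\Delta\oplus\mathbb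 R\delta$, fixing $\delta$, with $t_\xi v=v-(\xi,v)\delta$ for $v\in\operatorname{span}_{\mathbb R}\Delta$. For $w\in W$ and $\xi\in Q$ put $\ell^{\frac\infty2}(wt_\xi)=\ell(w)+2\langle\rho^\vee,\xi\rangle$, where $\rho^\vee=\frac12\sum_{\alpha\in\Delta^+}\alpha^\vee$. Let $J\subset I$. Let $\Delta_J$ be the set of roots in $\sum_{j\in J}\mathbb Z\alpha_j$, $\Delta_J^+=\Delta_J\cap\Delta^+$, $\rho_J^\vee=\frac12\sum_{\alpha\in\Delta_J^+}\alpha^\vee$, $W_J=\langle s_j: j\in J\rangle$, $W^J$ the set of minimal-length representatives of $W/W_J$, and $\lfloor w\rfloor^J\in W^J$ the representative of $wW_J$. Let $(W^J)_{\mathrm{af}}$ be the set of $x\in W_{\mathrm{af}}$ such that $x\beta\in\Delta_{\mathrm{af}}^+$ for all $\beta=\alpha+nc_\alpha\delta\in\Delta_{\mathrm{af}}^+$ with $\alpha\in\Delta_J$. An element $\xi\in Q$ is $J$-adjusted if $\langle\alpha^\vee,\xi\rangle\in\{-1,0\}$ for all $\alpha\in\Delta_J^+$; then $z_\xi$ denotes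 the unique element of $W_J$ with $z_\xi t_\xi\in(W^J)_{\mathrm{af}}$. The parabolic semi-infinite Bruhat graph $\tfrac\infty2\mathrm{BG}^J$ has vertex set $(W^J)_{\mathrm{af}}$ and an edge $x\xrightarrow{\beta}s_\beta x$ whenever $x,s_\beta x\in(W^J)_{\mathrm{af}}$, $\beta\in\Delta_{\mathrm{af}}^+$ and $\ell^{\frac\infty2}(s_\beta x)=\ell^{\frac\infty2}(x)+1$. The parabolic quantum Bruhat graph $\mathrm{QBG}^J$ has vertex set $W^J$ and, for $w\in W^J$, $\gamma\in\Delta^+\setminus\Delta_J^+$ and $v=\lfloor ws_\gamma\rfloor^J$, an edge $w\xrightarrow{\gamma}v$ if $\ell(v)=\ell(w)+1$ (a Bruhat edge) or $\ell(v)=\ell(w)-2\langle\rho^\vee-\rho_J^\vee,\gamma\rangle+1$ (a quantum edge). Then the following hold. (1) Let $x=wz_\xi t_\xi\in(W^J)_{\mathrm{af}}$ with $w\in W^J$ and $\xi\in Q$ $J$-adjusted, let $\beta\in\Delta_{\mathrm{af}}^+$, and let $x\xrightarrow{\beta}s_\beta x$ be an edge of $\tfrac\infty2\mathrm{BG}^J$.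 If $\beta=w\gamma$ (resp. $\beta=w\gamma+c_\gamma\delta$) with $\gamma\in\Delta^+\setminus\Delta_J^+$, then $w\xrightarrow{\gamma}\lfloor ws_\gamma\rfloor^J$ is a Bruhat edge (resp. a quantum edge) of $\mathrm{QBG}^J$. (2) Let $w\in W^J$ and $\gamma\in\Delta^+\setminus\Delta_J^+$. If $w\xrightarrow{\gamma}\lfloor ws_\gamma\rfloor^J$ is a Bruhat edge (resp. a quantum edge) of $\mathrm{QBG}^J$, then $\beta=w\gamma$ (resp. $\beta=w\gamma+c_\gamma\delta$) lies in $\Delta_{\mathrm{af}}^+$, and $wz_\xi t_\xi\xrightarrow{\beta}s_\beta wz_\xi t_\xi$ is an edge of $\tfrac\infty2\mathrm{BG}^J$ for every $J$-adjusted $\xi\in Q$. -/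

import Mathlib

open Module

noncomputable section

namespace DualUntwisted

/- Throughout, `P` is the finite root system `Δ` (roots in `M`, coroots in `N`), `b` a base of it
(the simple roots `α_i`, `i ∈ I = b.support`), and `M × ℝ` is the space `M ⊕ ℝδ` with `δ = (0, 1)`.
For `P` irreducible, reduced and not simply laced (type `B`, `C`, `F₄`, `G₂`), the real roots
`α + n c_α δ` below are those of the twisted affine Lie algebra of dual untwisted type
`D_{ℓ+1}^{(2)}`, `A_{2ℓ-1}^{(2)}`, `E_6^{(2)}`, `D_4^{(3)}` whose underlying finite root system
is `Δ`. -/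

variable {ι M N : Type*} [Fintype ι] [AddCommGroup M] [Module ℝ M] [AddCommGroup N] [Module ℝ N]
variable (P : RootPairing ι ℝ M N) (b : P.Base)

/-- The least squared length of a root, for the canonical invariant form. -/
def minSqLength : ℝ := ⨅ j, P.RootForm (P.root j) (P.root j)

/-- `c_α`: the squared length of `α` divided by that of a short root, so `c_α = 1` for short `α`,
and `c_α ∈ {2, 3}` for long `α` when `P` is not simply laced. -/
def c (i : ι) : ℝ := P.RootForm (P.root i) (P.root i) / minSqLength P

/-- The invariant form `( , )` normalised by `(α, α) = 2` for short roots,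
so that `(α, α) = 2 c_α` for every root `α`. -/
def form : LinearMap.BilinForm ℝ M := (2 / minSqLength P) • P.RootForm

/-- The affine real root `α_i + n c_i δ` with index `(i, n)`. -/
def affRoot (β : ι × ℤ) : M × ℝ := (P.root β.1, β.2 * c P β.1)

/-- The null root `δ`. -/
def delta : M × ℝ := (0, 1)

/-- Positive affine real roots: `α + n c_α δ` with `n > 0`, or with `n = 0` and `α ∈ Δ⁺`. -/
def AffPos {P : RootPairing ι ℝ M N} (b : P.Base) (β : ι × ℤ) : Prop :=
  0 < β.2 ∨ (β.2 = 0 ∧ b.IsPos β.1)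

/-- The reflection `s_β : v + mδ ↦ v + mδ - ⟨α^∨, v⟩ β` in the affine root `β = α + n c_α δ`
(the central element, by which `β^∨` and `α^∨` differ, acts on `M ⊕ ℝδ` by zero). -/
def s (β : ι × ℤ) : (M × ℝ) ≃ₗ[ℝ] (M × ℝ) :=
  reflection (x := affRoot P β) (f := (P.coroot' β.1).comp (LinearMap.fst ℝ M ℝ))
    (by simp [affRoot])

/-- The affine Weyl group, generated by the reflections in the real roots. -/
def Waf : Subgroup ((M × ℝ) ≃ₗ[ℝ] (M × ℝ)) := Subgroup.closure (Set.range (s P))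

/-- The parabolic subgroup `W_J` generated by the `s_j`, `j ∈ J`. -/
def parabolic (J : Set ι) : Subgroup ((M × ℝ) ≃ₗ[ℝ] (M × ℝ)) :=
  Subgroup.closure ((fun i => s P (i, 0)) '' J)

/-- The finite Weyl group `W`, generated by the simple reflections `s_i`, `i ∈ I`. -/
def W {P : RootPairing ι ℝ M N} (b : P.Base) : Subgroup ((M × ℝ) ≃ₗ[ℝ] (M × ℝ)) :=
  parabolic P (b.support : Set ι)

/-- The root lattice `Q`. -/
def rootLattice : Submodule ℤ M := Submodule.span ℤ (Set.range P.root)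

/-- The translation `t_ξ : v + mδ ↦ v + (m - (ξ, v))δ`, of interest for `ξ ∈ Q`. -/
def t (ξ : M) : (M × ℝ) ≃ₗ[ℝ] (M × ℝ) :=
  LinearEquiv.skewProd (LinearEquiv.refl ℝ M) (LinearEquiv.refl ℝ ℝ) (-(form P ξ))

/-- The length function of the finite Weyl group with respect to the simple reflections. -/
def length {P : RootPairing ι ℝ M N} (b : P.Base) (w : (M × ℝ) ≃ₗ[ℝ] (M × ℝ)) : ℕ :=
  sInf {n | ∃ l : List b.support, l.length = n ∧ (l.map fun i => s P (i, 0)).prod = w}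

/-- `i` is the index of a root of `Δ_J`, the roots in the span of the `α_j`, `j ∈ J`. -/
def InLevi (J : Set ι) (i : ι) : Prop := P.root i ∈ Submodule.span ℤ (P.root '' J)

open Classical in
/-- The pairing `⟨ρ_J^∨, x⟩`, where `ρ_J^∨` is half the sum of the coroots of `Δ_J⁺`. -/
def rhoCheck {P : RootPairing ι ℝ M N} (b : P.Base) (J : Set ι) (x : M) : ℝ :=
  (1 / 2) * ∑ i with b.IsPos i ∧ InLevi P J i, P.coroot' i x

/-- The set `W^J` of minimal-length representatives of the cosets in `W / W_J`. -/
def minReps {P : RootPairing ι ℝ M N} (b : P.Base) (J : Set ι) :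
    Set ((M × ℝ) ≃ₗ[ℝ] (M × ℝ)) :=
  {w | w ∈ W b ∧ ∀ u ∈ parabolic P J, length b w ≤ length b (w * u)}

/-- `⌊w⌋^J`: the element of minimal length in the coset `w W_J`. -/
def floor {P : RootPairing ι ℝ M N} (b : P.Base) (J : Set ι) (w : (M × ℝ) ≃ₗ[ℝ] (M × ℝ)) :
    (M × ℝ) ≃ₗ[ℝ] (M × ℝ) :=
  Function.argminOn (length b) {v | ∃ u ∈ parabolic P J, v = w * u}
    ⟨w, 1, Subgroup.one_mem _, (mul_one w).symm⟩

/-- `(W^J)_af`: the `x ∈ W_af` with `xβ ∈ Δ_af⁺` for all `β = α + n c_α δ ∈ Δ_af⁺`, `α ∈ Δ_J`. -/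
def peterson {P : RootPairing ι ℝ M N} (b : P.Base) (J : Set ι) :
    Set ((M × ℝ) ≃ₗ[ℝ] (M × ℝ)) :=
  {x | x ∈ Waf P ∧ ∀ β, AffPos b β → InLevi P J β.1 →
    ∃ β', AffPos b β' ∧ x (affRoot P β) = affRoot P β'}

/-- The `J`-adjusted elements of `Q`: `⟨α^∨, ξ⟩ ∈ {-1, 0}` for all `α ∈ Δ_J⁺`. -/
def adjusted {P : RootPairing ι ℝ M N} (b : P.Base) (J : Set ι) : Set M :=
  {ξ | ξ ∈ rootLattice P ∧
    ∀ i, b.IsPos i → InLevi P J i → P.coroot' i ξ = -1 ∨ P.coroot' i ξ = 0}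

/-- For `J`-adjusted `ξ`, the (unique) element `z_ξ ∈ W_J` with `z_ξ t_ξ ∈ (W^J)_af`. -/
def z {P : RootPairing ι ℝ M N} (b : P.Base) (J : Set ι) (ξ : M) : (M × ℝ) ≃ₗ[ℝ] (M × ℝ) :=
  Classical.epsilon fun u => u ∈ parabolic P J ∧ u * t P ξ ∈ peterson b J

open Classical in
/-- The semi-infinite length, `w t_ξ ↦ ℓ(w) + 2⟨ρ^∨, ξ⟩` for `w ∈ W`, `ξ ∈ Q`;
see `siLength_mul_t`. -/
def siLength {P : RootPairing ι ℝ M N} (b : P.Base) (x : (M × ℝ) ≃ₗ[ℝ] (M × ℝ)) : ℝ :=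
  if h : ∃ p : ((M × ℝ) ≃ₗ[ℝ] (M × ℝ)) × M, p.1 ∈ W b ∧ p.2 ∈ rootLattice P ∧ x = p.1 * t P p.2
  then length b h.choose.1 + 2 * rhoCheck b b.support h.choose.2
  else 0

/-- The edge `x → y` with label `β ∈ Δ_af⁺` in the parabolic semi-infinite Bruhat graph. -/
structure SiEdge {P : RootPairing ι ℝ M N} (b : P.Base) (J : Set ι)
    (x : (M × ℝ) ≃ₗ[ℝ] (M × ℝ)) (β : ι × ℤ) (y : (M × ℝ) ≃ₗ[ℝ] (M × ℝ)) : Prop where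
  source_mem : x ∈ peterson b J
  target_mem : y ∈ peterson b J
  pos : AffPos b β
  eq : y = s P β * x
  siLength_eq : siLength b y = siLength b x + 1

/-- The conditions common to all edges `w → v` with label `γ ∈ Δ⁺ ∖ Δ_J⁺` in `QBG^J`. -/
structure QBGEdgeData {P : RootPairing ι ℝ M N} (b : P.Base) (J : Set ι)
    (w : (M × ℝ) ≃ₗ[ℝ] (M × ℝ)) (γ : ι) (v : (M × ℝ) ≃ₗ[ℝ] (M × ℝ)) : Prop where
  source_mem : w ∈ minReps b J
  target_mem : v ∈ minReps b J
  pos : b.IsPos γ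
  notInLevi : ¬ InLevi P J γ
  eq : v = floor b J (w * s P (γ, 0))

/-- The Bruhat edges of the parabolic quantum Bruhat graph `QBG^J`. -/
structure BruhatEdge {P : RootPairing ι ℝ M N} (b : P.Base) (J : Set ι)
    (w : (M × ℝ) ≃ₗ[ℝ] (M × ℝ)) (γ : ι) (v : (M × ℝ) ≃ₗ[ℝ] (M × ℝ)) : Prop
    extends QBGEdgeData b J w γ v where
  length_eq : length b v = length b w + 1

/-- The quantum edges of the parabolic quantum Bruhat graph `QBG^J`. -/
structure QuantumEdge {P : RootPairing ι ℝ M N} (b : P.Base) (J : Set ι)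
    (w : (M × ℝ) ≃ₗ[ℝ] (M × ℝ)) (γ : ι) (v : (M × ℝ) ≃ₗ[ℝ] (M × ℝ)) : Prop
    extends QBGEdgeData b J w γ v where
  length_eq : (length b v : ℝ) =
    length b w - 2 * (rhoCheck b b.support (P.root γ) - rhoCheck b J (P.root γ)) + 1

/-! `siLength` does not depend on choices. -/

theorem parabolic_apply (J : Set ι) {w : (M × ℝ) ≃ₗ[ℝ] (M × ℝ)} (hw : w ∈ parabolic P J) :
    (∀ m : ℝ, w (0, m) = (0, m)) ∧ ∀ v : M, (w (v, 0)).2 = 0 := by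
  induction hw using Subgroup.closure_induction with
  | mem x hx =>
    obtain ⟨i, -, rfl⟩ := hx
    constructor
    · intro m; simp [s, reflection_apply]
    · intro v; simp [s, reflection_apply, affRoot]
  | one => simp
  | mul x y _ _ hx hy =>
    refine ⟨fun m => by rw [LinearEquiv.mul_apply, hy.1, hx.1], fun v => ?_⟩
    have : y (v, 0) = ((y (v, 0)).1, 0) := Prod.ext rfl (hy.2 v)
    rw [LinearEquiv.mul_apply, this, hx.2]
  | inv x _ hx =>
    have h1 : ∀ m : ℝ, x⁻¹ (0, m) = (0, m) := fun m => by
      rw [← hx.1 m, ← LinearEquiv.mul_apply, inv_mul_cancel]; simp [hx.1]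
    refine ⟨h1, fun v => ?_⟩
    have h2 : x (x⁻¹ (v, 0)) = (v, 0) := by
      rw [← LinearEquiv.mul_apply, mul_inv_cancel]; rfl
    have h3 : x⁻¹ (v, 0) = ((x⁻¹ (v, 0)).1, 0) + (0, (x⁻¹ (v, 0)).2) := by ext <;> simp
    have h4 := congrArg Prod.snd h2
    rw [h3, map_add, hx.1] at h4
    simpa [hx.2] using h4

theorem minSqLength_pos [Nonempty ι] : 0 < minSqLength P := by
  obtain ⟨j, hj⟩ := exists_eq_ciInf_of_finite (f := fun j => P.RootForm (P.root j) (P.root j))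
  rw [minSqLength, ← hj, P.rootForm_apply_apply]
  refine Finset.sum_pos' (fun i _ => mul_self_nonneg _) ⟨j, Finset.mem_univ _, by simp⟩

/-- The factorisation `w t_ξ` with `w ∈ W` is unique. -/
theorem mul_t_injective [Nonempty ι] [P.IsCrystallographic] [P.IsRootSystem]
    {w w' : (M × ℝ) ≃ₗ[ℝ] (M × ℝ)} {ξ ξ' : M} (hw : w ∈ W b) (hw' : w' ∈ W b)
    (h : w * t P ξ = w' * t P ξ') : w = w' ∧ ξ = ξ' := by
  have hu := parabolic_apply P _ ((W b).mul_mem ((W b).inv_mem hw') hw)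
  set u := w'⁻¹ * w with hu'
  have h1 : u * t P ξ = t P ξ' := by rw [hu', mul_assoc, h, inv_mul_cancel_left]
  have h2 : ∀ v : M, u (v, 0) + (0, -(form P ξ v)) = (v, -(form P ξ' v)) := fun v => by
    have := LinearEquiv.congr_fun h1 (v, 0)
    rw [LinearEquiv.mul_apply] at this
    have h3 : t P ξ (v, 0) = (v, 0) + (0, -(form P ξ v)) := by simp [t]
    rw [h3, map_add, hu.1] at this
    rw [this]; simp [t]
  have h4 : ∀ v : M, form P ξ v = form P ξ' v := fun v => by
    have := congrArg Prod.snd (h2 v)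
    simpa [hu.2 v] using this
  have hξ : ξ = ξ' := by
    rw [← sub_eq_zero]
    have hc : (2 / minSqLength P) ≠ 0 := by have := minSqLength_pos P; positivity
    refine P.rootForm_nondegenerate.1 _ fun v => ?_
    have := h4 v
    simp only [form, LinearMap.smul_apply, smul_eq_mul, mul_eq_mul_left_iff, hc, or_false] at this
    simp [this]
  refine ⟨?_, hξ⟩
  subst hξ
  exact mul_right_cancel h

theorem siLength_mul_t [Nonempty ι] [P.IsCrystallographic] [P.IsRootSystem]
    {w : (M × ℝ) ≃ₗ[ℝ] (M × ℝ)} {ξ : M} (hw : w ∈ W b) (hξ : ξ ∈ rootLattice P) :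
    siLength b (w * t P ξ) = length b w + 2 * rhoCheck b b.support ξ := by
  have h : ∃ p : ((M × ℝ) ≃ₗ[ℝ] (M × ℝ)) × M,
      p.1 ∈ W b ∧ p.2 ∈ rootLattice P ∧ w * t P ξ = p.1 * t P p.2 := ⟨(w, ξ), hw, hξ, rfl⟩
  obtain ⟨h1, -, h3⟩ := h.choose_spec
  obtain ⟨e1, e2⟩ := mul_t_injective P b hw h1 h3
  rw [siLength, dif_pos h, ← e1, ← e2]

/-- `s_{α + n c_α δ} = s_α t_{nα}`. -/
theorem s_eq_mul_t (i : ι) (n : ℤ) :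
    s P (i, n) = s P (i, 0) * t P ((n : ℝ) • P.root i) := by
  have key : ∀ v, 2 * P.RootForm (P.root i) v =
      P.RootForm (P.root i) (P.root i) * P.coroot' i v := fun v => by
    have h := congrArg (P.toLinearMap v) (P.rootForm_self_smul_coroot i)
    rw [map_smul, map_nsmul, P.toLinearMap_apply_apply_Polarization] at h
    simpa [two_mul, two_nsmul] using h.symm
  have key' : ∀ v, c P i * P.coroot' i v = 2 / minSqLength P * P.RootForm (P.root i) v := fun v => by
    rw [c, div_mul_eq_mul_div, ← key]; ring
  refine LinearEquiv.ext fun x => Prod.ext ?_ ?_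
  · simp [s, t, reflection_apply, affRoot]
  · have h := key' x.1
    rw [LinearMap.flip_apply] at h
    simp only [s, t, form, reflection_apply, affRoot, LinearEquiv.mul_apply,
      LinearEquiv.skewProd_apply, LinearMap.comp_apply, LinearMap.fst_apply, LinearMap.flip_apply,
      LinearEquiv.refl_apply, LinearMap.neg_apply, LinearMap.smul_apply, map_smul, smul_eq_mul,
      Prod.snd_sub, Prod.smul_snd, Int.cast_zero, zero_mul, mul_zero, sub_zero]
    linear_combination -(n : ℝ) * h

end DualUntwisted

end

/-! Let n = 0 for Bruhat edges and n = 1 for quantum edges, so that β = wγ + n c_γ δ. Moving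
translations to the right gives s_β w z_ξ t_ξ = w s_γ z_ξ t_{ξ + nγ'} with γ' = z_ξ⁻¹γ. On (W^J)_af
the semi-infinite length of u t_ξ is the number of roots of Δ⁺ ∖ Δ_J⁺ inverted by u, plus the sum of
⟨α^∨, ξ⟩ over the same roots (`siLength_of_mem_peterson`): the contributions of Δ_J⁺ to ℓ and to
2ρ^∨ cancel. As W_J permutes Δ⁺ ∖ Δ_J⁺, the factor z_ξ drops out, and the length conditions in the
two graphs become the same `EdgeCondition` (`siEdge_iff`). This settles (1).

For (2) it remains to see that s_β x lies in (W^J)_af, which reduces to w s_γ t_{nγ}. Put F(α) =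
n⟨α^∨, γ⟩ + (sgn wα - sgn w s_γ α)/2. The edge condition says that F sums to 1 over Δ⁺ ∖ Δ_J⁺. Now F
is odd under negation and under s_γ and has the sign of ⟨α^∨, γ⟩, which forces this sum to be at
least F(γ) ≥ 1; equality makes F vanish on Δ_J (`le_sum_and_eq_zero`). That vanishing is exactly the
membership criterion `mem_peterson_iff`. -/

namespace DualUntwisted

variable {ι M N : Type*} [Fintype ι] [AddCommGroup M] [Module ℝ M] [AddCommGroup N] [Module ℝ N]
variable {P : RootPairing ι ℝ M N} (b : P.Base)

/-! ### Heights -/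

section Heights

variable [P.IsRootSystem]

open Classical in
/-- The sum of the coordinates of a vector at the simple roots outside `K`. -/
noncomputable def heightOff (K : Set ι) : M →ₗ[ℝ] ℝ :=
  ∑ j : b.support, if (j : ι) ∈ K then 0 else b.toWeightBasis.coord j

omit [Fintype ι] in
open Classical in
theorem heightOff_root_of_mem_support (K : Set ι) {j : ι} (hj : j ∈ b.support) :
    heightOff b K (P.root j) = if j ∈ K then 0 else 1 := by
  have h : b.toWeightBasis.repr (P.root j) = Finsupp.single ⟨j, hj⟩ 1 :=
    b.toWeightBasis_repr_root ⟨j, hj⟩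
  rw [heightOff, LinearMap.sum_apply, Finset.sum_eq_single ⟨j, hj⟩]
  · split_ifs <;> simp [h]
  · rintro i - hi
    split_ifs
    · rfl
    · simp [h, hi.symm]
  · simp

omit [Fintype ι] in
theorem heightOff_root_nonneg_of_mem_support (K : Set ι) {j : ι} (hj : j ∈ b.support) :
    0 ≤ heightOff b K (P.root j) := by
  rw [heightOff_root_of_mem_support b K hj]; split_ifs <;> simp

omit [Fintype ι] in
theorem heightOff_root_of_mem {K : Set ι} (hK : K ⊆ b.support) {j : ι} (hj : j ∈ K) :
    heightOff b K (P.root j) = 0 := by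
  rw [heightOff_root_of_mem_support b K (hK hj), if_pos hj]

omit [Fintype ι] in
theorem mem_of_heightOff_root_eq_zero {K : Set ι} {j : ι} (hj : j ∈ b.support)
    (h : heightOff b K (P.root j) = 0) : j ∈ K := by
  by_contra hK
  rw [heightOff_root_of_mem_support b K hj, if_neg hK] at h
  exact one_ne_zero h

variable [P.IsCrystallographic]

theorem heightOff_root_nonneg {b : P.Base} (K : Set ι) {i : ι} (hi : b.IsPos i) :
    0 ≤ heightOff b K (P.root i) := by
  refine hi.induction_on_add (fun j hj => heightOff_root_nonneg_of_mem_support b K hj) ?_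
  intro i j k hk h hj
  rw [hk, map_add]
  exact add_nonneg h (heightOff_root_nonneg_of_mem_support b K hj)

theorem heightOff_empty_root_pos {b : P.Base} {i : ι} (hi : b.IsPos i) :
    0 < heightOff b ∅ (P.root i) := by
  refine hi.induction_on_add (p := fun i => 0 < heightOff b ∅ (P.root i)) (fun j hj => ?_) ?_
  · simp [heightOff_root_of_mem_support b ∅ hj]
  · intro i j k hk h hj
    rw [hk, map_add]
    exact add_pos_of_pos_of_nonneg h (heightOff_root_nonneg_of_mem_support b ∅ hj)

/-- The index of the negative of a root. -/
def neg (P : RootPairing ι ℝ M N) (i : ι) : ι := P.reflectionPerm i i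

omit [Fintype ι] [P.IsRootSystem] [P.IsCrystallographic] in
@[simp] theorem root_neg (i : ι) : P.root (neg P i) = -P.root i := by
  simp [neg, P.root_reflectionPerm]

omit [Fintype ι] [P.IsRootSystem] [P.IsCrystallographic] in
@[simp] theorem neg_neg (i : ι) : neg P (neg P i) = i := P.root.injective (by simp)

omit [Fintype ι] [P.IsRootSystem] [P.IsCrystallographic] in
theorem isPos_neg (i : ι) : b.IsPos (neg P i) ↔ ¬ b.IsPos i :=
  RootPairing.Base.IsPos.neg_iff_not b i

theorem isPos_iff_heightOff (i : ι) : b.IsPos i ↔ 0 < heightOff b ∅ (P.root i) := by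
  refine ⟨heightOff_empty_root_pos, fun h => ?_⟩
  by_contra hi
  have := heightOff_empty_root_pos ((isPos_neg b i).2 hi)
  rw [root_neg, map_neg] at this
  linarith

theorem not_isPos_iff_heightOff (i : ι) : ¬ b.IsPos i ↔ heightOff b ∅ (P.root i) < 0 := by
  rw [← isPos_neg, isPos_iff_heightOff, root_neg, map_neg, neg_pos]

/-- A positive root is built by adding simple roots one at a time, each of nonnegative height, so
total height zero forces every summand into J. Membership in Δ_J thus becomes the vanishing of a
linear functional. -/
theorem heightOff_root_eq_zero_iff {J : Set ι} (hJ : J ⊆ b.support) (i : ι) :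
    heightOff b J (P.root i) = 0 ↔ InLevi P J i := by
  constructor
  · have key : ∀ i, b.IsPos i → heightOff b J (P.root i) = 0 → InLevi P J i := by
      intro i hi
      refine (hi.induction_on_add (p := fun i => 0 ≤ heightOff b J (P.root i) ∧
        (heightOff b J (P.root i) = 0 → InLevi P J i)) (fun j hj => ?_) ?_).2
      · exact ⟨heightOff_root_nonneg_of_mem_support b J hj, fun h =>
          Submodule.subset_span ⟨j, mem_of_heightOff_root_eq_zero b hj h, rfl⟩⟩
      · rintro i j k hk ⟨h1, h2⟩ hj
        have h3 := heightOff_root_nonneg_of_mem_support b J hj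
        rw [InLevi, hk, map_add]
        refine ⟨add_nonneg h1 h3, fun h => add_mem (h2 (by linarith)) ?_⟩
        exact Submodule.subset_span
          ⟨j, mem_of_heightOff_root_eq_zero b hj (by linarith), rfl⟩
    intro h
    by_cases hi : b.IsPos i
    · exact key i hi h
    · have := key (neg P i) ((isPos_neg b i).2 hi) (by simp [h])
      rw [InLevi, root_neg] at this
      exact neg_mem_iff.1 this
  · intro h
    rw [InLevi] at h
    generalize P.root i = x at h
    induction h using Submodule.span_induction with
    | mem x hx => obtain ⟨j, hj, rfl⟩ := hx; exact heightOff_root_of_mem b hJ hj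
    | zero => simp
    | add x y _ _ hx hy => simp [hx, hy]
    | smul a x _ hx => simp [map_zsmul, hx]

theorem heightOff_root_pos_iff {J : Set ι} (hJ : J ⊆ b.support) (i : ι) :
    0 < heightOff b J (P.root i) ↔ b.IsPos i ∧ ¬ InLevi P J i := by
  rw [← heightOff_root_eq_zero_iff b hJ]
  constructor
  · refine fun h => ⟨?_, h.ne'⟩
    by_contra hi
    have := heightOff_root_nonneg J ((isPos_neg b i).2 hi)
    rw [root_neg, map_neg] at this
    linarith
  · exact fun ⟨h, h'⟩ => lt_of_le_of_ne (heightOff_root_nonneg J h) (Ne.symm h')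

end Heights

/-! ### The action on roots -/

section Action

/-- The linear map `w` fixes `δ`, permutes the finite roots by `π`, and is compatible with
coroots. -/
structure Realizes (P : RootPairing ι ℝ M N) (w : (M × ℝ) ≃ₗ[ℝ] (M × ℝ)) (π : Equiv.Perm ι) :
    Prop where
  map_root : ∀ i, w (P.root i, 0) = (P.root (π i), 0)
  map_delta : ∀ r : ℝ, w (0, r) = (0, r)
  coroot_map : ∀ i x, P.coroot' (π i) (w x).1 = P.coroot' i x.1

namespace Realizes

variable {w u : (M × ℝ) ≃ₗ[ℝ] (M × ℝ)} {π σ : Equiv.Perm ι}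

omit [Fintype ι] in
theorem one : Realizes P 1 1 := ⟨fun _ => rfl, fun _ => rfl, fun _ _ => rfl⟩

omit [Fintype ι] in
theorem mul (hw : Realizes P w π) (hu : Realizes P u σ) : Realizes P (w * u) (π * σ) where
  map_root i := by simp [LinearEquiv.mul_apply, hu.map_root, hw.map_root]
  map_delta r := by simp [LinearEquiv.mul_apply, hu.map_delta, hw.map_delta]
  coroot_map i x := by
    rw [LinearEquiv.mul_apply, Equiv.Perm.mul_apply, hw.coroot_map, hu.coroot_map]

omit [Fintype ι] in
theorem inv (hw : Realizes P w π) : Realizes P w⁻¹ π⁻¹ where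
  map_root i := by
    apply w.injective
    rw [← LinearEquiv.mul_apply, mul_inv_cancel, hw.map_root]
    simp
  map_delta r := by
    apply w.injective
    rw [← LinearEquiv.mul_apply, mul_inv_cancel, hw.map_delta]
    simp
  coroot_map i x := by
    rw [← hw.coroot_map, ← LinearEquiv.mul_apply, mul_inv_cancel]
    simp

omit [Fintype ι] in
theorem map_root_add (hw : Realizes P w π) (i : ι) (r : ℝ) :
    w (P.root i, r) = (P.root (π i), r) := by
  have : (P.root i, r) = (P.root i, (0 : ℝ)) + (0, r) := by simp
  rw [this, map_add, hw.map_root, hw.map_delta]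
  simp

omit [Fintype ι] in
theorem map_add_smul (hw : Realizes P w π) {i j k : ι} {a : ℝ}
    (h : P.root k = P.root i + a • P.root j) :
    P.root (π k) = P.root (π i) + a • P.root (π j) := by
  have h1 : (P.root k, (0 : ℝ)) = (P.root i, 0) + a • (P.root j, 0) := by simp [h]
  have h2 := congrArg w h1
  rw [map_add, map_smul, hw.map_root, hw.map_root, hw.map_root] at h2
  simpa using congrArg Prod.fst h2

omit [Fintype ι] in
theorem perm_neg (hw : Realizes P w π) (i : ι) : π (neg P i) = neg P (π i) := by
  apply P.root.injective
  rw [hw.map_add_smul (i := i) (j := i) (k := neg P i) (a := -2)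
    (by rw [root_neg]; module), root_neg]
  module

/-- The form is the sum over all coroots of products of their values, and π only permutes the
summands. -/
theorem rootForm_map (hw : Realizes P w π) (x y : M × ℝ) :
    P.RootForm (w x).1 (w y).1 = P.RootForm x.1 y.1 := by
  rw [P.rootForm_apply_apply, P.rootForm_apply_apply, ← Equiv.sum_comp π]
  simp only [hw.coroot_map]

theorem c_perm (hw : Realizes P w π) (i : ι) : c P (π i) = c P i := by
  have := hw.rootForm_map (P.root i, 0) (P.root i, 0)
  rw [hw.map_root] at this
  rw [c, c, this]

theorem map_affRoot (hw : Realizes P w π) (i : ι) (n : ℤ) :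
    w (affRoot P (i, n)) = affRoot P (π i, n) := by
  simp only [affRoot, hw.map_root_add, hw.c_perm]

theorem mul_s (hw : Realizes P w π) (i : ι) (n : ℤ) :
    w * s P (i, n) = s P (π i, n) * w := by
  ext1 x
  simp only [LinearEquiv.mul_apply, s, reflection_apply, map_sub, map_smul, hw.map_affRoot,
    LinearMap.comp_apply, LinearMap.fst_apply, hw.coroot_map]

end Realizes

theorem s_zero_apply (i : ι) (x : M × ℝ) : s P (i, 0) x = (P.reflection i x.1, x.2) := by
  ext <;> simp [s, affRoot, reflection_apply, RootPairing.reflection_apply]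

theorem realizes_s (i : ι) : Realizes P (s P (i, 0)) (P.reflectionPerm i) where
  map_root j := by rw [s_zero_apply, P.root_reflectionPerm]
  map_delta r := by simp [s_zero_apply]
  coroot_map j x := by
    rw [s_zero_apply, P.coroot'_reflectionPerm]
    simp

omit [Fintype ι] in
theorem root_reflectionPerm_eq (i j : ι) :
    P.root (P.reflectionPerm i j) = P.root j + (-P.pairing j i) • P.root i := by
  rw [P.root_reflectionPerm, P.reflection_apply_root]; module

variable [P.IsRootSystem]

/-- The height off J is preserved because s_j changes a root by a multiple of α_j, which has height
zero off J. -/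
theorem exists_realizes_of_mem_parabolic {J : Set ι} (hJ : J ⊆ b.support)
    {w : (M × ℝ) ≃ₗ[ℝ] (M × ℝ)} (hw : w ∈ parabolic P J) :
    ∃ π, Realizes P w π ∧ ∀ i, heightOff b J (P.root (π i)) = heightOff b J (P.root i) := by
  induction hw using Subgroup.closure_induction with
  | mem x hx =>
    obtain ⟨j, hj, rfl⟩ := hx
    refine ⟨_, realizes_s j, fun i => ?_⟩
    rw [root_reflectionPerm_eq, map_add, map_smul, heightOff_root_of_mem b hJ hj]
    simp
  | one => exact ⟨1, Realizes.one, fun _ => rfl⟩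
  | mul x y _ _ hx hy =>
    obtain ⟨π, h1, h2⟩ := hx
    obtain ⟨σ, h3, h4⟩ := hy
    exact ⟨π * σ, h1.mul h3, fun i => by rw [Equiv.Perm.mul_apply, h2, h4]⟩
  | inv x _ hx =>
    obtain ⟨π, h1, h2⟩ := hx
    exact ⟨π⁻¹, h1.inv, fun i => by rw [← h2]; simp⟩

variable {b} in
theorem exists_realizes {w : (M × ℝ) ≃ₗ[ℝ] (M × ℝ)} (hw : w ∈ W b) : ∃ π, Realizes P w π :=
  let ⟨π, h, _⟩ := exists_realizes_of_mem_parabolic b subset_rfl hw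
  ⟨π, h⟩

omit [P.IsRootSystem] in
theorem parabolic_le_W {J : Set ι} (hJ : J ⊆ b.support) : parabolic P J ≤ W b :=
  Subgroup.closure_mono (Set.image_mono hJ)

end Action

/-! ### Length and inversions -/

section Length

variable [P.IsRootSystem] [P.IsCrystallographic]

open Classical in
/-- The number of roots of positive height off `J` made negative by `π`. -/
noncomputable def invCount (J : Set ι) (π : Equiv.Perm ι) : ℕ :=
  Finset.card {i | 0 < heightOff b J (P.root i) ∧ ¬ b.IsPos (π i)}

theorem invCount_empty_one : invCount b ∅ (1 : Equiv.Perm ι) = 0 := by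
  simp [invCount, ← isPos_iff_heightOff]

-- Reindexing by σ preserves the height condition, so the count off J depends only on the coset
-- modulo W_J.
omit [P.IsCrystallographic] in
theorem invCount_mul {J : Set ι} (π : Equiv.Perm ι) {σ : Equiv.Perm ι}
    (hσ : ∀ i, heightOff b J (P.root (σ i)) = heightOff b J (P.root i)) :
    invCount b J (π * σ) = invCount b J π := by
  classical
  refine Finset.card_bij (fun i _ => σ i) (fun i hi => ?_) (fun i _ j _ h => σ.injective h)
    (fun j hj => ⟨σ.symm j, ?_, by simp⟩)
  · simp only [Finset.mem_filter, Finset.mem_univ, true_and] at hi ⊢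
    simpa only [hσ, Equiv.Perm.mul_apply] using hi
  · have := hσ (σ.symm j)
    rw [Equiv.apply_symm_apply] at this
    simp only [Finset.mem_filter, Finset.mem_univ, true_and] at hj ⊢
    simpa [← this] using hj

variable [P.IsReduced]

/-- The reflection s_j permutes the positive roots other than α_j and negates α_j, so the only new
inversion is α_j itself. -/
theorem invCount_mul_reflectionPerm {w : (M × ℝ) ≃ₗ[ℝ] (M × ℝ)} {π : Equiv.Perm ι}
    (hw : Realizes P w π) {j : ι} (hj : j ∈ b.support) (h : b.IsPos (π j)) :
    invCount b ∅ (π * P.reflectionPerm j) = invCount b ∅ π + 1 := by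
  classical
  have hjp := b.isPos_of_mem_support hj
  have hnj : ¬ b.IsPos (neg P j) := by rw [isPos_neg]; exact not_not.2 hjp
  have hjj : P.reflectionPerm j j = neg P j := rfl
  have hne : ∀ i, b.IsPos i → i ≠ neg P j := fun i hi e => hnj (e ▸ hi)
  simp only [invCount, ← isPos_iff_heightOff, Equiv.Perm.mul_apply]
  have hmem : j ∈ ({i | b.IsPos i ∧ ¬ b.IsPos (π (P.reflectionPerm j i))} : Finset ι) := by
    simp [hjp, hjj, hw.perm_neg, isPos_neg, h]
  rw [← Finset.card_erase_add_one hmem]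
  congr 1
  have hbij : ∀ i, b.IsPos i → i ≠ j →
      b.IsPos (P.reflectionPerm j i) ∧ P.reflectionPerm j i ≠ j := by
    refine fun i hi hij => ⟨hi.reflectionPerm hj hij, fun e => hne i hi ?_⟩
    rw [← P.reflectionPerm_self j i, e, hjj]
  refine Finset.card_bij (fun i _ => P.reflectionPerm j i) ?_
    (fun i _ k _ h => (P.reflectionPerm j).injective h) ?_
  · intro i hi
    simp only [Finset.mem_erase, Finset.mem_filter, Finset.mem_univ, true_and] at hi ⊢
    exact ⟨(hbij i hi.2.1 hi.1).1, hi.2.2⟩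
  · intro i hi
    simp only [Finset.mem_filter, Finset.mem_univ, true_and] at hi
    have hij : i ≠ j := fun e => hi.2 (e ▸ h)
    refine ⟨P.reflectionPerm j i, ?_, P.reflectionPerm_self j i⟩
    simp only [Finset.mem_erase, Finset.mem_filter, Finset.mem_univ, true_and]
    refine ⟨(hbij i hi.1 hij).2, (hbij i hi.1 hij).1, ?_⟩
    simpa using hi.2

theorem invCount_mul_reflectionPerm_add_one {w : (M × ℝ) ≃ₗ[ℝ] (M × ℝ)} {π : Equiv.Perm ι}
    (hw : Realizes P w π) {j : ι} (hj : j ∈ b.support) (h : ¬ b.IsPos (π j)) :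
    invCount b ∅ (π * P.reflectionPerm j) + 1 = invCount b ∅ π := by
  have := invCount_mul_reflectionPerm b (hw.mul (realizes_s j)) hj ?_
  · rw [← this, mul_assoc, ← sq, P.reflectionPerm_sq, mul_one]
  · rw [Equiv.Perm.mul_apply, show P.reflectionPerm j j = neg P j from rfl, hw.perm_neg,
      isPos_neg]
    exact h

/-- The product of the simple reflections in a word. -/
noncomputable def wordProd (l : List b.support) : (M × ℝ) ≃ₗ[ℝ] (M × ℝ) :=
  (l.map fun i : b.support => s P ((i : ι), 0)).prod

/-- The permutation of the roots given by a word. -/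
def wordPerm (l : List b.support) : Equiv.Perm ι :=
  (l.map fun i : b.support => P.reflectionPerm (i : ι)).prod

omit [P.IsRootSystem] [P.IsCrystallographic] [P.IsReduced] in
theorem realizes_wordProd (l : List b.support) : Realizes P (wordProd b l) (wordPerm b l) := by
  induction l with
  | nil => exact Realizes.one
  | cons i l ih => simpa [wordProd, wordPerm] using (realizes_s (i : ι)).mul ih

-- The root α_j must change sign at some letter i of the word. There the part l to the right of i
-- sends α_j to α_i, so s_i l s_j = l and the letter i can be dropped.
omit [P.IsRootSystem] in
theorem exists_word_deletion (l : List b.support) {j : ι} (hj : j ∈ b.support)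
    (h : ¬ b.IsPos (wordPerm b l j)) :
    ∃ l' : List b.support, wordProd b l' = wordProd b l * s P (j, 0) ∧
      l'.length + 1 = l.length := by
  induction l with
  | nil => exact absurd (b.isPos_of_mem_support hj) h
  | cons i l ih =>
    by_cases hl : b.IsPos (wordPerm b l j)
    · refine ⟨l, ?_, rfl⟩
      -- The only positive root that s_i makes negative is α_i.
      have hi : wordPerm b l j = i := by
        by_contra hne
        exact h (by simpa [wordPerm] using hl.reflectionPerm i.2 hne)
      have h1 := (realizes_wordProd b l).mul_s j 0
      have h2 : s P ((i : ι), 0) * s P ((i : ι), 0) = 1 := by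
        ext1 x
        simp [LinearEquiv.mul_apply, s_zero_apply]
      rw [show wordProd b (i :: l) = s P ((i : ι), 0) * wordProd b l by simp [wordProd],
        mul_assoc, h1, hi, ← mul_assoc, h2, one_mul]
    · obtain ⟨l', h1, h2⟩ := ih hl
      refine ⟨i :: l', ?_, by simp [h2]⟩
      simp only [wordProd, List.map_cons, List.prod_cons] at h1 ⊢
      rw [h1, mul_assoc]

/-- Each further letter changes the inversion count by one: on an increase it is appended to the
short word, on a decrease the deletion property shortens that word. -/
theorem exists_word_length_eq (l : List b.support) :
    ∃ l' : List b.support, wordProd b l' = wordProd b l ∧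
      l'.length = invCount b ∅ (wordPerm b l) := by
  induction l using List.reverseRecOn with
  | nil => exact ⟨[], rfl, (invCount_empty_one b).symm⟩
  | append_singleton l j ih =>
    obtain ⟨l', h1, h2⟩ := ih
    have hr := realizes_wordProd b l
    have hperm : wordPerm b (l ++ [j]) = wordPerm b l * P.reflectionPerm j := by simp [wordPerm]
    have hprod : ∀ l : List b.support,
        wordProd b (l ++ [j]) = wordProd b l * s P ((j : ι), 0) := by simp [wordProd]
    by_cases hp : b.IsPos (wordPerm b l j)
    · refine ⟨l' ++ [j], by rw [hprod, hprod, h1], ?_⟩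
      rw [hperm, invCount_mul_reflectionPerm b hr j.2 hp, ← h2, List.length_append]
      rfl
    · have hpe : wordPerm b l' j = wordPerm b l j := by
        have e := (realizes_wordProd b l').map_root j
        rw [h1, hr.map_root] at e
        exact P.root.injective (congrArg Prod.fst e).symm
      obtain ⟨l'', h3, h4⟩ := exists_word_deletion b l' j.2 (hpe ▸ hp)
      refine ⟨l'', by rw [h3, hprod, h1], ?_⟩
      have := invCount_mul_reflectionPerm_add_one b hr j.2 hp
      rw [hperm]
      omega

theorem invCount_wordPerm_le (l : List b.support) :
    invCount b ∅ (wordPerm b l) ≤ l.length := by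
  induction l using List.reverseRecOn with
  | nil => exact (invCount_empty_one b).le
  | append_singleton l j ih =>
    have hr := realizes_wordProd b l
    have hperm : wordPerm b (l ++ [j]) = wordPerm b l * P.reflectionPerm j := by simp [wordPerm]
    rw [hperm, List.length_append, List.length_singleton]
    by_cases hp : b.IsPos (wordPerm b l j)
    · rw [invCount_mul_reflectionPerm b hr j.2 hp]; omega
    · have := invCount_mul_reflectionPerm_add_one b hr j.2 hp
      omega

omit [P.IsReduced] [P.IsCrystallographic] [P.IsRootSystem] in
theorem exists_wordProd_eq {w : (M × ℝ) ≃ₗ[ℝ] (M × ℝ)} (hw : w ∈ W b) :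
    ∃ l, wordProd b l = w := by
  induction hw using Subgroup.closure_induction with
  | mem x hx => obtain ⟨j, hj, rfl⟩ := hx; exact ⟨[⟨j, hj⟩], by simp [wordProd]⟩
  | one => exact ⟨[], rfl⟩
  | mul x y _ _ hx hy =>
    obtain ⟨l, rfl⟩ := hx
    obtain ⟨l', rfl⟩ := hy
    exact ⟨l ++ l', by simp [wordProd]⟩
  | inv x _ hx =>
    obtain ⟨l, rfl⟩ := hx
    refine ⟨l.reverse, ?_⟩
    have h2 : ∀ i : ι, (s P (i, 0))⁻¹ = s P (i, 0) := by
      intro i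
      rw [inv_eq_iff_mul_eq_one]
      ext1 x
      simp [LinearEquiv.mul_apply, s_zero_apply]
    simp [wordProd, List.prod_inv_reverse, Function.comp_def, h2]

omit [P.IsReduced] [P.IsCrystallographic] [P.IsRootSystem] [Fintype ι] in
theorem Realizes.perm_eq {w : (M × ℝ) ≃ₗ[ℝ] (M × ℝ)} {π σ : Equiv.Perm ι}
    (h : Realizes P w π) (h' : Realizes P w σ) : π = σ := by
  ext i
  have e := h.map_root i
  rw [h'.map_root] at e
  exact P.root.injective (congrArg Prod.fst e).symm

theorem length_eq_invCount {w : (M × ℝ) ≃ₗ[ℝ] (M × ℝ)} {π : Equiv.Perm ι} (hw : w ∈ W b)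
    (hπ : Realizes P w π) : length b w = invCount b ∅ π := by
  obtain ⟨l, hl⟩ := exists_wordProd_eq b hw
  have hperm : ∀ l, wordProd b l = w → wordPerm b l = π := by
    rintro l rfl
    exact (realizes_wordProd b l).perm_eq hπ
  have hlen : length b w = sInf {n | ∃ l : List b.support, l.length = n ∧ wordProd b l = w} := by
    simp [length, wordProd]
  rw [hlen]
  refine le_antisymm ?_ (le_csInf ⟨l.length, l, rfl, hl⟩ ?_)
  · obtain ⟨l', h1, h2⟩ := exists_word_length_eq b l
    rw [hperm l hl] at h2
    exact Nat.sInf_le ⟨l', h2, h1.trans hl⟩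
  · rintro n ⟨l', rfl, h⟩
    rw [← hperm l' h]
    exact invCount_wordPerm_le b l'

/-! ### Minimal coset representatives and their lengths -/

/-- If wα_j were negative for some j ∈ J, then w s_j would be a shorter element of the coset.
Positivity then passes from the simple roots in J to their sums. -/
theorem isPos_of_mem_minReps {J : Set ι} (hJ : J ⊆ b.support) {w : (M × ℝ) ≃ₗ[ℝ] (M × ℝ)}
    {π : Equiv.Perm ι} (hw : w ∈ minReps b J) (hπ : Realizes P w π) {i : ι} (hi : b.IsPos i)
    (hiJ : InLevi P J i) : b.IsPos (π i) := by
  have simple : ∀ j ∈ J, b.IsPos (π j) := by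
    intro j hj
    by_contra h
    have h1 := invCount_mul_reflectionPerm_add_one b hπ (hJ hj) h
    have hs : s P (j, 0) ∈ parabolic P J := Subgroup.subset_closure ⟨j, hj, rfl⟩
    have h2 := hw.2 _ hs
    rw [length_eq_invCount b hw.1 hπ, length_eq_invCount b
      ((W b).mul_mem hw.1 (parabolic_le_W b hJ hs)) (hπ.mul (realizes_s j))] at h2
    omega
  rw [← heightOff_root_eq_zero_iff b hJ] at hiJ
  refine (hi.induction_on_add (p := fun i => 0 ≤ heightOff b J (P.root i) ∧
    (heightOff b J (P.root i) = 0 → b.IsPos (π i))) (fun j hj => ?_) ?_).2 hiJ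
  · exact ⟨heightOff_root_nonneg_of_mem_support b J hj, fun h =>
      simple j (mem_of_heightOff_root_eq_zero b hj h)⟩
  · rintro i j k hk ⟨h1, h2⟩ hj
    have h3 := heightOff_root_nonneg_of_mem_support b J hj
    rw [hk, map_add]
    refine ⟨add_nonneg h1 h3, fun h => (h2 (by linarith)).add
      (simple j (mem_of_heightOff_root_eq_zero b hj (by linarith))) ?_⟩
    have := hπ.map_add_smul (i := i) (j := j) (k := k) (a := 1) (by simp [hk])
    simpa using this

omit [P.IsReduced] [P.IsCrystallographic] [P.IsRootSystem] in
theorem floor_mem_coset (J : Set ι) (u : (M × ℝ) ≃ₗ[ℝ] (M × ℝ)) :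
    ∃ y ∈ parabolic P J, floor b J u = u * y :=
  Function.argminOn_mem (length b) {v | ∃ y ∈ parabolic P J, v = u * y} _

omit [P.IsReduced] [P.IsCrystallographic] [P.IsRootSystem] in
theorem floor_mem_minReps {J : Set ι} (hJ : J ⊆ b.support) {u : (M × ℝ) ≃ₗ[ℝ] (M × ℝ)}
    (hu : u ∈ W b) : floor b J u ∈ minReps b J := by
  obtain ⟨y, hy, h⟩ := floor_mem_coset b J u
  refine ⟨h ▸ (W b).mul_mem hu (parabolic_le_W b hJ hy), fun v hv => ?_⟩
  exact Function.argminOn_le (length b) {v | ∃ y ∈ parabolic P J, v = u * y}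
    ⟨y * v, mul_mem hy hv, by rw [h, mul_assoc]⟩

/-- A minimal representative inverts no root of Δ_J⁺, so all its inversions have positive height off
J. -/
theorem length_of_mem_minReps {J : Set ι} (hJ : J ⊆ b.support) {w : (M × ℝ) ≃ₗ[ℝ] (M × ℝ)}
    {π : Equiv.Perm ι} (hw : w ∈ minReps b J) (hπ : Realizes P w π) :
    length b w = invCount b J π := by
  rw [length_eq_invCount b hw.1 hπ, invCount, invCount]
  congr 1
  ext i
  simp only [Finset.mem_filter, Finset.mem_univ, true_and, heightOff_root_pos_iff b hJ,
    ← isPos_iff_heightOff]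
  have := fun h => isPos_of_mem_minReps b hJ hw hπ (i := i) h
  tauto

theorem length_floor {J : Set ι} (hJ : J ⊆ b.support) {u : (M × ℝ) ≃ₗ[ℝ] (M × ℝ)}
    {π : Equiv.Perm ι} (hu : u ∈ W b) (hπ : Realizes P u π) :
    length b (floor b J u) = invCount b J π := by
  obtain ⟨y, hy, h⟩ := floor_mem_coset b J u
  obtain ⟨σ, hσ, hσJ⟩ := exists_realizes_of_mem_parabolic b hJ hy
  rw [length_of_mem_minReps b hJ (floor_mem_minReps b hJ hu) (h ▸ hπ.mul hσ), invCount_mul b π hσJ]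

end Length

/-! ### A sum over the roots of positive height -/

section Sums

variable [P.IsRootSystem] [P.IsCrystallographic]

omit [Fintype ι] [P.IsRootSystem] in
theorem pairing_pos_comm [Finite ι] {i j : ι} : 0 < P.pairing i j ↔ 0 < P.pairing j i := by
  have h := P.zero_lt_pairingIn_iff' (S := ℤ) (i := i) (j := j)
  rw [← P.algebraMap_pairingIn ℤ, ← P.algebraMap_pairingIn ℤ j i]
  simpa using h

omit [Fintype ι] [P.IsCrystallographic] [P.IsRootSystem] in
theorem reflectionPerm_neg (γ i : ι) :
    P.reflectionPerm γ (neg P i) = neg P (P.reflectionPerm γ i) := by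
  apply P.root.injective
  simp [P.root_reflectionPerm]

omit [Fintype ι] [P.IsCrystallographic] [P.IsRootSystem] in
theorem pairing_neg (γ i : ι) : P.pairing γ (neg P i) = -P.pairing γ i :=
  P.pairing_reflectionPerm_self_right γ i

/-- The sign of the height off `J` of the root with index `i`. -/
noncomputable def signOff (J : Set ι) (i : ι) : ℝ := SignType.sign (heightOff b J (P.root i))

omit [Fintype ι] [P.IsCrystallographic] in
theorem signOff_neg (J : Set ι) (i : ι) : signOff b J (neg P i) = -signOff b J i := by
  simp [signOff, Left.sign_neg]

omit [Fintype ι] [P.IsCrystallographic] in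
theorem signOff_mono {J : Set ι} {i j : ι}
    (h : heightOff b J (P.root i) ≤ heightOff b J (P.root j)) : signOff b J i ≤ signOff b J j := by
  have := SignType.sign.monotone h
  rw [signOff, signOff]
  revert this
  generalize SignType.sign (heightOff b J (P.root i)) = x
  generalize SignType.sign (heightOff b J (P.root j)) = y
  cases x <;> cases y <;> intro h <;> first | (exact absurd h (by decide)) | simp

omit [Fintype ι] [P.IsCrystallographic] in
theorem signOff_of_pos {J : Set ι} {i : ι} (h : 0 < heightOff b J (P.root i)) :
    signOff b J i = 1 := by
  simp [signOff, h]

omit [Fintype ι] [P.IsCrystallographic] in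
theorem signOff_of_neg {J : Set ι} {i : ι} (h : heightOff b J (P.root i) < 0) :
    signOff b J i = -1 := by
  simp [signOff, h]

-- Both the sign and F are odd, so α and -α contribute equally; roots of height zero contribute
-- nothing.
open Classical in
omit [P.IsCrystallographic] in
theorem sum_signOff_mul (J : Set ι) {F : ι → ℝ} (hneg : ∀ i, F (neg P i) = -F i) :
    ∑ i, signOff b J i * F i = 2 * ∑ i with 0 < heightOff b J (P.root i), F i := by
  have h1 : ∀ i, signOff b J i * F i = (if 0 < heightOff b J (P.root i) then F i else 0) +
      (if 0 < heightOff b J (P.root (neg P i)) then F (neg P i) else 0) := by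
    intro i
    simp only [root_neg, map_neg, neg_pos, hneg]
    rcases lt_trichotomy (heightOff b J (P.root i)) 0 with h | h | h
    · rw [signOff_of_neg b h, if_neg h.le.not_gt, if_pos h]; ring
    · simp [signOff, h]
    · rw [signOff_of_pos b h, if_neg h.le.not_gt, if_pos h]; ring
  have h2 : ∑ i, (if 0 < heightOff b J (P.root (neg P i)) then F (neg P i) else 0) =
      ∑ i, if 0 < heightOff b J (P.root i) then F i else 0 :=
    Equiv.sum_comp (Function.Involutive.toPerm (neg P) neg_neg)
      (fun i => if 0 < heightOff b J (P.root i) then F i else 0)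
  rw [Finset.sum_congr rfl fun i _ => h1 i, Finset.sum_add_distrib, h2, ← two_mul,
    Finset.sum_filter]

open Classical in
/-- For `F` odd under negation and under `s_γ`, with the sign of `⟨γ, ·^∨⟩`, the sum of `F` over
the positive roots outside `Δ_J` is at least `F γ`, and `F` vanishes on `Δ_J` in case of
equality. -/
theorem le_sum_and_eq_zero {J : Set ι} {γ : ι} (hγ : 0 < heightOff b J (P.root γ)) {F : ι → ℝ}
    (hneg : ∀ i, F (neg P i) = -F i) (hs : ∀ i, F (P.reflectionPerm γ i) = -F i)
    (hF : ∀ i, 0 < P.pairing γ i → 0 ≤ F i) :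
    F γ ≤ ∑ i with 0 < heightOff b J (P.root i), F i ∧
      (∑ i with 0 < heightOff b J (P.root i), F i ≤ F γ →
        ∀ i, heightOff b J (P.root i) = 0 → F i = 0) := by
  -- Antisymmetrising the sign under s_γ makes every term nonnegative: s_γ lowers the height off J
  -- exactly where ⟨α, γ^∨⟩ > 0, which is where F is nonnegative.
  set T : ι → ℝ := fun i => (signOff b J i - signOff b J (P.reflectionPerm γ i)) * F i with hT
  have hheight : ∀ i, heightOff b J (P.root (P.reflectionPerm γ i)) =
      heightOff b J (P.root i) - P.pairing i γ * heightOff b J (P.root γ) := by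
    intro i
    rw [root_reflectionPerm_eq, map_add, map_smul, smul_eq_mul]; ring
  have hFzero : ∀ i, P.pairing i γ = 0 → F i = 0 := by
    intro i hi
    have h1 := hs i
    rw [show P.reflectionPerm γ i = i from P.root.injective (by
      rw [root_reflectionPerm_eq, hi]; simp)] at h1
    linarith
  have hTpos : ∀ i, 0 < P.pairing i γ → 0 ≤ T i := by
    intro i hi
    refine mul_nonneg (sub_nonneg.2 (signOff_mono b ?_)) (hF i (pairing_pos_comm.1 hi))
    rw [hheight]
    have := mul_pos hi hγ
    linarith
  have hTneg : ∀ i, T (neg P i) = T i := by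
    intro i
    simp only [hT, hneg, signOff_neg, reflectionPerm_neg]; ring
  have hpneg : ∀ i, P.pairing (neg P i) γ = -P.pairing i γ := fun i =>
    P.pairing_reflectionPerm_self_left i γ
  have hT0 : ∀ i, 0 ≤ T i := by
    intro i
    rcases lt_trichotomy (P.pairing i γ) 0 with h | h | h
    · rw [← hTneg]
      exact hTpos _ (by rw [hpneg]; linarith)
    · simp [hT, hFzero i h]
    · exact hTpos i h
  have hTγ : T γ = 2 * F γ := by
    have : P.reflectionPerm γ γ = neg P γ := rfl
    simp only [hT, this, signOff_neg, signOff_of_pos b hγ]; ring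
  -- One factor 2 comes from F being odd under s_γ, the other from folding α and -α together.
  have hsum : ∑ i, T i = 4 * ∑ i with 0 < heightOff b J (P.root i), F i := by
    have h1 : ∑ i, signOff b J (P.reflectionPerm γ i) * F i = -∑ i, signOff b J i * F i := by
      rw [← Equiv.sum_comp (P.reflectionPerm γ) fun i => signOff b J i * F i,
        ← Finset.sum_neg_distrib]
      exact Finset.sum_congr rfl fun i _ => by rw [hs]; ring
    simp only [hT, sub_mul, Finset.sum_sub_distrib, h1, sum_signOff_mul b J hneg]
    ring
  have hne : γ ≠ neg P γ := by
    intro e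
    have := congrArg (fun i => heightOff b J (P.root i)) e
    simp only [root_neg, map_neg] at this
    linarith
  constructor
  -- The roots ±γ alone contribute 4 F(γ) to the total of T.
  · have h := Finset.sum_le_univ_sum_of_nonneg (s := {γ, neg P γ}) hT0
    rw [Finset.sum_pair hne, hTneg, hTγ, hsum] at h
    linarith
  · intro heq i hi
    by_cases hp : P.pairing i γ = 0
    · exact hFzero i hp
    have h := Finset.sum_le_univ_sum_of_nonneg (s := {i, γ, neg P γ}) hT0
    have hi1 : i ≠ γ := by rintro rfl; linarith
    have hi2 : i ≠ neg P γ := by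
      rintro rfl
      rw [root_neg, map_neg] at hi
      linarith
    rw [Finset.sum_insert (by simp [hi1, hi2]), Finset.sum_pair hne, hTneg, hTγ, hsum] at h
    have hTi : T i = 0 := le_antisymm (by linarith) (hT0 i)
    refine (mul_eq_zero.1 hTi).resolve_left ?_
    -- A root of Δ_J not orthogonal to γ has sign 0, while its image under s_γ has nonzero height
    -- off J. Its coefficient in T is therefore ±1, and T = 0 gives F = 0.
    have h0 : signOff b J i = 0 := by simp [signOff, hi]
    have h1 := hheight i
    rw [hi, zero_sub] at h1
    rw [h0, zero_sub, neg_eq_zero, signOff, h1]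
    rcases lt_or_gt_of_ne hp with h | h
    · rw [sign_pos (by have := mul_neg_of_neg_of_pos h hγ; linarith)]; simp
    · rw [sign_neg (by have := mul_pos h hγ; linarith)]; simp

omit [Fintype ι] [P.IsCrystallographic] in
theorem signOff_eq_one_or_neg_one [Finite ι] [P.IsCrystallographic] (i : ι) :
    signOff b ∅ i = 1 ∧ b.IsPos i ∨ signOff b ∅ i = -1 ∧ ¬ b.IsPos i := by
  have := Fintype.ofFinite ι
  by_cases h : b.IsPos i
  · exact .inl ⟨signOff_of_pos b ((isPos_iff_heightOff b i).1 h), h⟩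
  · exact .inr ⟨signOff_of_neg b ((not_isPos_iff_heightOff b i).1 h), h⟩

open Classical in
theorem invCount_eq_sum (J : Set ι) (π : Equiv.Perm ι) :
    (invCount b J π : ℝ) =
      ∑ i with 0 < heightOff b J (P.root i), (1 - signOff b ∅ (π i)) / 2 := by
  rw [invCount, Finset.card_eq_sum_ones, Nat.cast_sum, ← Finset.filter_filter,
    Finset.sum_filter]
  refine Finset.sum_congr rfl fun i _ => ?_
  rcases signOff_eq_one_or_neg_one b (π i) with ⟨h, h'⟩ | ⟨h, h'⟩ <;> simp [h, h']

open Classical in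
/-- The criterion for edges: the length condition of the quantum Bruhat graph
(`n = 0` for Bruhat edges and `n = 1` for quantum edges) determines the signs of the roots of
`w s_γ t_{nγ} Δ_J`. -/
theorem isPos_and_pairing_of_invCount_eq {J : Set ι} {γ : ι}
    (hγ : 0 < heightOff b J (P.root γ)) {w : (M × ℝ) ≃ₗ[ℝ] (M × ℝ)} {π : Equiv.Perm ι}
    (hw : Realizes P w π) {n : ℤ} (hn : n = 0 ∨ n = 1)
    (h : (invCount b J (π * P.reflectionPerm γ) : ℝ) +
        n * ∑ i with 0 < heightOff b J (P.root i), P.pairing γ i = invCount b J π + 1) :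
    (n = 0 → b.IsPos (π γ)) ∧ ∀ i, heightOff b J (P.root i) = 0 → b.IsPos (π i) →
      n * P.pairing γ i = 0 ∧ b.IsPos (π (P.reflectionPerm γ i)) ∨
      n * P.pairing γ i = -1 ∧ ¬ b.IsPos (π (P.reflectionPerm γ i)) := by
  set F : ι → ℝ := fun i => n * P.pairing γ i +
    (signOff b ∅ (π i) - signOff b ∅ (π (P.reflectionPerm γ i))) / 2 with hF
  -- Half the difference of signs is the inversion indicator for w s_γ minus that for w, so this is
  -- the length condition rewritten.
  have hsum : ∑ i with 0 < heightOff b J (P.root i), F i = 1 := by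
    have : ∀ i, F i = n * P.pairing γ i + ((1 - signOff b ∅ (π (P.reflectionPerm γ i))) / 2 -
        (1 - signOff b ∅ (π i)) / 2) := fun i => by simp only [hF]; ring
    simp only [this, Finset.sum_add_distrib, Finset.sum_sub_distrib, ← Finset.mul_sum]
    rw [invCount_eq_sum, invCount_eq_sum] at h
    simp only [Equiv.Perm.mul_apply] at h
    linarith
  have hneg : ∀ i, F (neg P i) = -F i := by
    intro i
    simp only [hF, pairing_neg, reflectionPerm_neg, hw.perm_neg, signOff_neg]; ring
  have hs : ∀ i, F (P.reflectionPerm γ i) = -F i := by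
    intro i
    have : P.pairing γ (P.reflectionPerm γ i) = -P.pairing γ i := by
      rw [P.pairing_reflectionPerm, P.pairing_reflectionPerm_self_left]
    simp only [hF, this, P.reflectionPerm_self]; ring
  have hγγ : signOff b ∅ (π (P.reflectionPerm γ γ)) = -signOff b ∅ (π γ) := by
    rw [show P.reflectionPerm γ γ = neg P γ from rfl, hw.perm_neg, signOff_neg]
  have hFγ : F γ = 2 * n + signOff b ∅ (π γ) := by
    simp only [hF, hγγ, P.pairing_same]; ring
  have hheight : ∀ i, heightOff b ∅ (P.root (π (P.reflectionPerm γ i))) =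
      heightOff b ∅ (P.root (π i)) - P.pairing i γ * heightOff b ∅ (P.root (π γ)) := by
    intro i
    rw [hw.map_add_smul (root_reflectionPerm_eq γ i), map_add, map_smul, smul_eq_mul]; ring
  have hpos : (n = 0 → b.IsPos (π γ)) := by
    rintro rfl
    by_contra hc
    -- For n = 0 and wγ negative, -F has the required signs, and the inequality reads 1 ≤ -1.
    have h1 := (le_sum_and_eq_zero b hγ (F := fun i => -F i) (fun i => by rw [hneg])
      (fun i => by rw [hs]) (fun i hi => ?_)).1
    · rw [Finset.sum_neg_distrib, hsum, hFγ,
        signOff_of_neg b ((not_isPos_iff_heightOff b _).1 hc)] at h1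
      norm_num at h1
    · have h2 : signOff b ∅ (π i) ≤ signOff b ∅ (π (P.reflectionPerm γ i)) := by
        apply signOff_mono
        rw [hheight]
        have := mul_neg_of_pos_of_neg (pairing_pos_comm.1 hi)
          ((not_isPos_iff_heightOff b _).1 hc)
        linarith
      simp only [hF, Int.cast_zero]
      linarith
  refine ⟨hpos, ?_⟩
  have hsign : ∀ i, 0 < P.pairing γ i → 0 ≤ F i := by
    intro i hi
    rcases hn with rfl | rfl
    · have h2 : signOff b ∅ (π (P.reflectionPerm γ i)) ≤ signOff b ∅ (π i) := by
        apply signOff_mono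
        rw [hheight]
        have := mul_pos (pairing_pos_comm.1 hi) ((isPos_iff_heightOff b _).1 (hpos rfl))
        linarith
      simp only [hF, Int.cast_zero]
      linarith
    -- Integrality matters here: the sign term can be as low as -1, which a positive integer pairing
    -- compensates.
    · have h1 : (1 : ℝ) ≤ P.pairing γ i := by
        rw [← P.algebraMap_pairingIn ℤ] at hi ⊢
        simp only [algebraMap_int_eq, eq_intCast, Int.cast_pos] at hi ⊢
        exact_mod_cast hi
      simp only [hF, Int.cast_one]
      rcases signOff_eq_one_or_neg_one b (π i) with ⟨h2, -⟩ | ⟨h2, -⟩ <;>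
      rcases signOff_eq_one_or_neg_one b (π (P.reflectionPerm γ i)) with ⟨h3, -⟩ | ⟨h3, -⟩ <;>
      rw [h2, h3] <;> linarith
  have hFγ1 : 1 ≤ F γ := by
    rw [hFγ]
    rcases hn with rfl | rfl
    · rw [signOff_of_pos b ((isPos_iff_heightOff b _).1 (hpos rfl))]; norm_num
    · rcases signOff_eq_one_or_neg_one b (π γ) with ⟨h2, -⟩ | ⟨h2, -⟩ <;> rw [h2] <;> norm_num
  intro i hi hπi
  -- The sum is 1 ≤ F(γ), so equality holds and F vanishes on Δ_J.
  have h0 := (le_sum_and_eq_zero b hγ hneg hs hsign).2 (by rw [hsum]; exact hFγ1) i hi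
  simp only [hF] at h0
  rw [signOff_of_pos b ((isPos_iff_heightOff b _).1 hπi)] at h0
  rcases signOff_eq_one_or_neg_one b (π (P.reflectionPerm γ i)) with ⟨h3, h4⟩ | ⟨h3, h4⟩
  · exact .inl ⟨by rw [h3] at h0; linarith, h4⟩
  · exact .inr ⟨by rw [h3] at h0; linarith, h4⟩

end Sums

/-! ### Translations -/

section Translations

theorem two_mul_rootForm (i : ι) (v : M) :
    2 * P.RootForm (P.root i) v = P.RootForm (P.root i) (P.root i) * P.coroot' i v := by
  have h := congrArg (P.toLinearMap v) (P.rootForm_self_smul_coroot i)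
  rw [map_smul, map_nsmul, P.toLinearMap_apply_apply_Polarization] at h
  simpa [two_mul, two_nsmul] using h.symm

theorem rootForm_self_pos (i : ι) : 0 < P.RootForm (P.root i) (P.root i) := by
  rw [P.rootForm_apply_apply]
  exact Finset.sum_pos' (fun i _ => mul_self_nonneg _) ⟨i, Finset.mem_univ _, by simp⟩

theorem c_pos (i : ι) : 0 < c P i :=
  have : Nonempty ι := ⟨i⟩
  div_pos (rootForm_self_pos i) (minSqLength_pos P)

/-- The normalisation makes (α, α) = 2c_α. The δ-shift of a translation is therefore c_α times ⟨α^∨,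
ξ⟩, an integer for ξ ∈ Q, so translations by Q preserve the affine roots. -/
theorem form_root (ξ : M) (i : ι) : form P ξ (P.root i) = c P i * P.coroot' i ξ := by
  rw [c, div_mul_eq_mul_div, ← two_mul_rootForm, form, LinearMap.smul_apply,
    LinearMap.smul_apply, smul_eq_mul, P.rootForm_symmetric.eq (P.root i) ξ |>.symm]
  simp only [RingHom.id_apply]
  ring

omit [Fintype ι] in
theorem exists_int_coroot [P.IsCrystallographic] {ξ : M} (hξ : ξ ∈ rootLattice P) (i : ι) :
    ∃ k : ℤ, P.coroot' i ξ = k := by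
  induction hξ using Submodule.span_induction with
  | mem x hx =>
    obtain ⟨j, rfl⟩ := hx
    exact ⟨P.pairingIn ℤ j i, by simpa using (P.algebraMap_pairingIn ℤ j i).symm⟩
  | zero => exact ⟨0, by simp⟩
  | add x y _ _ hx hy =>
    obtain ⟨k, hk⟩ := hx
    obtain ⟨l, hl⟩ := hy
    exact ⟨k + l, by rw [map_add, hk, hl]; push_cast; rfl⟩
  | smul a x _ hx =>
    obtain ⟨k, hk⟩ := hx
    exact ⟨a * k, by rw [map_zsmul, hk]; simp⟩

theorem affRoot_injective : Function.Injective (affRoot P) := by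
  rintro ⟨i, n⟩ ⟨j, m⟩ h
  have hij : i = j := P.root.injective (congrArg Prod.fst h)
  subst hij
  have := mul_right_cancel₀ (c_pos i).ne' (congrArg Prod.snd h)
  simpa using this

theorem t_affRoot {ξ : M} {i : ι} {k : ℤ} (hk : P.coroot' i ξ = k) (n : ℤ) :
    t P ξ (affRoot P (i, n)) = affRoot P (i, n - k) := by
  have := form_root (P := P) ξ i
  rw [hk] at this
  ext
  · simp [t, affRoot]
  · simp [t, affRoot, this]; ring

theorem Realizes.mul_t_affRoot {u : (M × ℝ) ≃ₗ[ℝ] (M × ℝ)} {π : Equiv.Perm ι}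
    (hu : Realizes P u π) {ξ : M} {i : ι} {k : ℤ} (hk : P.coroot' i ξ = k) (n : ℤ) :
    (u * t P ξ) (affRoot P (i, n)) = affRoot P (π i, n - k) := by
  rw [LinearEquiv.mul_apply, t_affRoot hk, hu.map_affRoot]

theorem t_zero : t P (0 : M) = 1 := by
  ext x <;> simp [t]

theorem t_add (ξ η : M) : t P (ξ + η) = t P ξ * t P η := by
  ext x <;> simp [t, LinearEquiv.mul_apply]
  ring

theorem W_le_Waf : W b ≤ Waf P :=
  Subgroup.closure_mono (Set.image_subset_range _ _ |>.trans
    (Set.range_subset_iff.2 fun i => ⟨(i, 0), rfl⟩))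

theorem t_smul_root (i : ι) (n : ℤ) :
    t P ((n : ℝ) • P.root i) = (s P (i, 0))⁻¹ * s P (i, n) := by
  rw [s_eq_mul_t P i n, inv_mul_cancel_left]

/-- The translation is a product of two reflections, and w conjugates each to the reflection in the
image root. -/
theorem Realizes.mul_t_smul_root {w : (M × ℝ) ≃ₗ[ℝ] (M × ℝ)} {π : Equiv.Perm ι}
    (hw : Realizes P w π) (i : ι) (n : ℤ) :
    w * t P ((n : ℝ) • P.root i) = t P ((n : ℝ) • P.root (π i)) * w := by
  rw [t_smul_root, t_smul_root, mul_assoc, ← hw.mul_s i n, ← mul_assoc, ← mul_assoc]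
  congr 1
  rw [mul_inv_eq_iff_eq_mul, mul_assoc, hw.mul_s, inv_mul_cancel_left]

theorem t_mem_Waf {ξ : M} (hξ : ξ ∈ rootLattice P) : t P ξ ∈ Waf P := by
  have hs : ∀ β, s P β ∈ Waf P := fun β => Subgroup.subset_closure ⟨β, rfl⟩
  induction hξ using Submodule.span_induction with
  | mem x hx =>
    obtain ⟨i, rfl⟩ := hx
    have := t_smul_root (P := P) i 1
    rw [Int.cast_one, one_smul] at this
    rw [this]
    exact mul_mem (inv_mem (hs _)) (hs _)
  | zero => rw [t_zero]; exact one_mem _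
  | add x y _ _ hx hy => rw [t_add]; exact mul_mem hx hy
  | smul a x _ hx =>
    have : ∀ n : ℕ, t P (n • x) ∈ Waf P := by
      intro n
      induction n with
      | zero => rw [zero_smul, t_zero]; exact one_mem _
      | succ n ih => rw [succ_nsmul, t_add]; exact mul_mem ih hx
    obtain ⟨n, rfl | rfl⟩ := a.eq_nat_or_neg
    · simpa using this n
    · have h : t P (-(n • x)) = (t P (n • x))⁻¹ := by
        rw [eq_inv_iff_mul_eq_one, ← t_add, neg_add_cancel, t_zero]
      simpa [h] using this n

end Translations

/-! ### The set `(W^J)_af` -/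

section Peterson

variable [P.IsRootSystem] [P.IsCrystallographic]

-- Write k = ⟨α^∨, ξ⟩ for α ∈ Δ_J⁺. Positivity of the image of α gives k ≤ 0 and that of -α + c_α δ
-- gives k ≥ -1; the boundary cases fix the sign of uα. These two roots suffice, since adding
-- further multiples of δ preserves positivity.
omit [P.IsRootSystem] in
theorem mem_peterson_iff {J : Set ι} {u : (M × ℝ) ≃ₗ[ℝ] (M × ℝ)} {π : Equiv.Perm ι}
    (hu : u ∈ W b) (hπ : Realizes P u π) {ξ : M} (hξ : ξ ∈ rootLattice P) :
    u * t P ξ ∈ peterson b J ↔ ∀ i, b.IsPos i → InLevi P J i →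
      P.coroot' i ξ = 0 ∧ b.IsPos (π i) ∨ P.coroot' i ξ = -1 ∧ ¬ b.IsPos (π i) := by
  have hneg : ∀ i, P.coroot' (neg P i) ξ = -P.coroot' i ξ := by
    intro i
    simp [neg]
  have hLevi : ∀ i, InLevi P J i → InLevi P J (neg P i) := by
    intro i hi
    rw [InLevi, root_neg]
    exact neg_mem hi
  constructor
  · rintro ⟨-, h⟩ i hi hiJ
    obtain ⟨k, hk⟩ := exists_int_coroot hξ i
    obtain ⟨β, hβ, e⟩ := h (i, 0) (.inr ⟨rfl, hi⟩) hiJ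
    rw [hπ.mul_t_affRoot hk] at e
    obtain rfl := affRoot_injective e
    have hk' : P.coroot' (neg P i) ξ = ((-k : ℤ) : ℝ) := by rw [hneg, hk]; simp
    obtain ⟨β, hβ', e⟩ := h (neg P i, 1) (.inl one_pos) (hLevi i hiJ)
    rw [hπ.mul_t_affRoot hk'] at e
    obtain rfl := affRoot_injective e
    simp only [AffPos, hπ.perm_neg, isPos_neg] at hβ hβ'
    rw [hk]
    have h3 : k = 0 ∧ b.IsPos (π i) ∨ k = -1 ∧ ¬ b.IsPos (π i) := by
      rcases hβ with h1 | ⟨h1, h1'⟩ <;> rcases hβ' with h2 | ⟨h2, h2'⟩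
      · omega
      · exact .inr ⟨by omega, h2'⟩
      · exact .inl ⟨by omega, h1'⟩
      · omega
    exact_mod_cast h3
  · intro h
    refine ⟨mul_mem (W_le_Waf b hu) (t_mem_Waf hξ), ?_⟩
    rintro ⟨i, n⟩ hβ hiJ
    obtain ⟨k, hk⟩ := exists_int_coroot hξ i
    refine ⟨_, ?_, hπ.mul_t_affRoot hk n⟩
    simp only [AffPos] at hβ hiJ ⊢
    by_cases hi : b.IsPos i
    · have h1 := h i hi hiJ
      rw [hk] at h1
      norm_cast at h1
      rcases h1 with ⟨h1, h2⟩ | ⟨h1, h2⟩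
      · rcases hβ with h3 | ⟨h3, -⟩
        · left; omega
        · exact .inr ⟨by omega, h2⟩
      · left; omega
    · have h1 := h (neg P i) ((isPos_neg b i).2 hi) (hLevi i hiJ)
      rw [hneg, hk, hπ.perm_neg, isPos_neg, not_not] at h1
      norm_cast at h1
      rcases h1 with ⟨h1, h2⟩ | ⟨h1, h2⟩
      · rcases hβ with h3 | ⟨h3, h4⟩
        · left; omega
        · exact absurd h4 hi
      · rcases hβ with h3 | ⟨h3, h4⟩
        · by_cases hn : n = 1
          · exact .inr ⟨by omega, h2⟩
          · left; omega
        · exact absurd h4 hi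

variable [P.IsReduced]

/-- Every additively closed choice of signs on `Δ_J` is conjugate under `W_J` to the standard
one. -/
theorem exists_mem_parabolic_isPos_iff {J : Set ι} (hJ : J ⊆ b.support) (T : ι → Prop)
    (hadd : ∀ i j k, P.root k = P.root i + P.root j → T i → T j → T k)
    (hneg : ∀ i, T (neg P i) ↔ ¬ T i) :
    ∃ y ∈ parabolic P J, ∃ σ, Realizes P y σ ∧
      ∀ i, InLevi P J i → (T i ↔ b.IsPos (σ i)) := by
  classical
  -- Induction on the number of positive roots of Δ_J with the wrong sign; reflecting in a wrongly
  -- signed simple root lowers it.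
  obtain ⟨m, hm⟩ : ∃ m, m = Finset.card {i | b.IsPos i ∧ InLevi P J i ∧ ¬ T i} := ⟨_, rfl⟩
  induction m using Nat.strong_induction_on generalizing T with
  | _ m ih =>
  by_cases hall : ∀ j ∈ J, T j
  · refine ⟨1, one_mem _, 1, Realizes.one, ?_⟩
    have key : ∀ i, b.IsPos i → InLevi P J i → T i := by
      intro i hi hiJ
      rw [← heightOff_root_eq_zero_iff b hJ] at hiJ
      refine (hi.induction_on_add (p := fun i => 0 ≤ heightOff b J (P.root i) ∧
        (heightOff b J (P.root i) = 0 → T i)) (fun j hj => ?_) ?_).2 hiJ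
      · exact ⟨heightOff_root_nonneg_of_mem_support b J hj, fun h =>
          hall j (mem_of_heightOff_root_eq_zero b hj h)⟩
      · rintro i j k hk ⟨h1, h2⟩ hj
        have h3 := heightOff_root_nonneg_of_mem_support b J hj
        rw [hk, map_add]
        exact ⟨add_nonneg h1 h3, fun h => hadd _ _ _ hk (h2 (by linarith))
          (hall j (mem_of_heightOff_root_eq_zero b hj (by linarith)))⟩
    intro i hiJ
    refine ⟨fun hT => ?_, fun hi => key i hi hiJ⟩
    by_contra hi
    refine (hneg i).1 (key _ ((isPos_neg b i).2 hi) ?_) hT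
    rw [InLevi, root_neg]
    exact neg_mem hiJ
  · push Not at hall
    obtain ⟨j, hj, hTj⟩ := hall
    have hjs := hJ hj
    have hLevi : ∀ i, InLevi P J (P.reflectionPerm j i) ↔ InLevi P J i := by
      intro i
      rw [← heightOff_root_eq_zero_iff b hJ, ← heightOff_root_eq_zero_iff b hJ,
        root_reflectionPerm_eq, map_add, map_smul, heightOff_root_of_mem b hJ hj]
      simp
    have hjJ : InLevi P J j := Submodule.subset_span ⟨j, hj, rfl⟩
    have hjj : P.reflectionPerm j j = neg P j := rfl
    have hlt : Finset.card {i | b.IsPos i ∧ InLevi P J i ∧ ¬ T (P.reflectionPerm j i)} < m := by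
      rw [hm]
      have hmem : j ∈ ({i | b.IsPos i ∧ InLevi P J i ∧ ¬ T i} : Finset ι) := by
        simp [b.isPos_of_mem_support hjs, hjJ, hTj]
      rw [← Finset.card_erase_add_one hmem, Nat.lt_succ_iff]
      -- After the reflection α_j is correct, and s_j carries the remaining wrong roots injectively
      -- to old wrong roots other than α_j.
      refine Finset.card_le_card_of_injOn (P.reflectionPerm j) (fun i hi => ?_)
        (P.reflectionPerm j).injective.injOn
      simp only [Finset.coe_filter, Finset.mem_univ, true_and, Set.mem_ofPred_eq,
        Finset.coe_erase, Set.mem_sdiff, Set.mem_singleton_iff] at hi ⊢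
      have hij : i ≠ j := by
        rintro rfl
        rw [hjj, hneg] at hi
        exact hi.2.2 hTj
      refine ⟨⟨hi.1.reflectionPerm hjs hij, (hLevi i).2 hi.2.1, hi.2.2⟩, fun e => ?_⟩
      have : i = neg P j := by rw [← P.reflectionPerm_self j i, e, hjj]
      rw [this, isPos_neg] at hi
      exact hi.1 (b.isPos_of_mem_support hjs)
    obtain ⟨y, hy, σ, hσ, h⟩ := ih _ hlt (fun i => T (P.reflectionPerm j i))
      (fun i k l h hi hk => hadd _ _ _ (by
        rw [P.root_reflectionPerm, P.root_reflectionPerm, P.root_reflectionPerm, h, map_add])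
        hi hk)
      (fun i => by rw [reflectionPerm_neg, hneg]) rfl
    refine ⟨y * s P (j, 0), mul_mem hy (Subgroup.subset_closure ⟨j, hj, rfl⟩), _,
      hσ.mul (realizes_s j), fun i hi => ?_⟩
    rw [Equiv.Perm.mul_apply, ← h _ ((hLevi i).2 hi), P.reflectionPerm_self]

theorem exists_mul_t_mem_peterson {J : Set ι} (hJ : J ⊆ b.support) {ξ : M}
    (hξ : ξ ∈ adjusted b J) : ∃ y ∈ parabolic P J, y * t P ξ ∈ peterson b J := by
  -- Sign of (α, ξ), with ties broken by positivity of α. The form replaces the coroot pairing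
  -- because it is additive in the root and has the same sign.
  set T : ι → Prop := fun i =>
    0 < P.RootForm (P.root i) ξ ∨ P.RootForm (P.root i) ξ = 0 ∧ b.IsPos i with hT
  have hadd : ∀ i j k, P.root k = P.root i + P.root j → T i → T j → T k := by
    simp only [hT]
    intro i j k hk hi hj
    have : P.RootForm (P.root k) ξ = P.RootForm (P.root i) ξ + P.RootForm (P.root j) ξ := by
      rw [hk, map_add, LinearMap.add_apply]
    rw [this]
    rcases hi with hi | ⟨hi, hi'⟩ <;> rcases hj with hj | ⟨hj, hj'⟩
    · left; linarith
    · left; linarith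
    · left; linarith
    · exact .inr ⟨by linarith, hi'.add hj' hk⟩
  have hneg : ∀ i, T (neg P i) ↔ ¬ T i := by
    simp only [hT]
    intro i
    rw [root_neg, isPos_neg, map_neg, LinearMap.neg_apply, neg_pos, neg_eq_zero]
    rcases lt_trichotomy (P.RootForm (P.root i) ξ) 0 with h | h | h
    · simp [h, h.ne, h.le.not_gt]
    · simp [h]
    · simp [h, h.ne', h.le.not_gt]
  obtain ⟨y, hy, σ, hσ, h⟩ := exists_mem_parabolic_isPos_iff b hJ T hadd hneg
  refine ⟨y, hy, (mem_peterson_iff b (parabolic_le_W b hJ hy) hσ hξ.1).2 ?_⟩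
  intro i hi hiJ
  have h1 := h i hiJ
  have h2 := two_mul_rootForm (P := P) i ξ
  have h3 := rootForm_self_pos (P := P) i
  rcases hξ.2 i hi hiJ with h4 | h4
  · refine .inr ⟨h4, fun h5 => ?_⟩
    rw [h4] at h2
    rcases h1.2 h5 with h6 | ⟨h6, -⟩ <;> linarith
  · refine .inl ⟨h4, h1.1 (.inr ⟨?_, hi⟩)⟩
    rw [h4] at h2
    linarith

theorem z_spec {J : Set ι} (hJ : J ⊆ b.support) {ξ : M} (hξ : ξ ∈ adjusted b J) :
    z b J ξ ∈ parabolic P J ∧ z b J ξ * t P ξ ∈ peterson b J :=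
  Classical.epsilon_spec (exists_mul_t_mem_peterson b hJ hξ)

omit [P.IsReduced] in
open Classical in
theorem two_mul_rhoCheck_sub {J : Set ι} (hJ : J ⊆ b.support) (x : M) :
    2 * (rhoCheck b b.support x - rhoCheck b J x) =
      ∑ i with 0 < heightOff b J (P.root i), P.coroot' i x := by
  have hsupp : ∀ i, InLevi P (b.support : Set ι) i := b.root_mem_span_int
  simp only [rhoCheck, hsupp, and_true, heightOff_root_pos_iff b hJ]
  rw [← Finset.sum_filter_add_sum_filter_not ({i | b.IsPos i} : Finset ι) (InLevi P J),
    Finset.filter_filter, Finset.filter_filter]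
  ring

-- Each inversion of u in Δ_J⁺ has ⟨α^∨, ξ⟩ = -1 and every other root of Δ_J⁺ has pairing 0. Inside
-- Δ_J the inversion count thus cancels 2⟨ρ_J^∨, ξ⟩.
open Classical in
theorem siLength_of_mem_peterson [Nonempty ι] {J : Set ι} (hJ : J ⊆ b.support)
    {u : (M × ℝ) ≃ₗ[ℝ] (M × ℝ)} {π : Equiv.Perm ι} (hu : u ∈ W b) (hπ : Realizes P u π) {ξ : M}
    (hξ : ξ ∈ rootLattice P) (h : u * t P ξ ∈ peterson b J) :
    siLength b (u * t P ξ) = invCount b J π +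
      ∑ i with 0 < heightOff b J (P.root i), P.coroot' i ξ := by
  rw [siLength_mul_t P b hu hξ, ← two_mul_rhoCheck_sub b hJ, length_eq_invCount b hu hπ]
  have h1 : (invCount b ∅ π : ℝ) = invCount b J π - 2 * rhoCheck b J ξ := by
    have h2 := (mem_peterson_iff b hu hπ hξ).1 h
    have h3 : (invCount b ∅ π : ℝ) = invCount b J π +
        Finset.card {i | (b.IsPos i ∧ InLevi P J i) ∧ ¬ b.IsPos (π i)} := by
      rw [← Nat.cast_add, invCount, invCount, ← Finset.card_union_of_disjoint]
      · congr 2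
        ext i
        simp only [Finset.mem_union, Finset.mem_filter, Finset.mem_univ, true_and,
          heightOff_root_pos_iff b hJ, ← isPos_iff_heightOff]
        tauto
      · rw [Finset.disjoint_left]
        intro i
        simp only [Finset.mem_filter, Finset.mem_univ, true_and, heightOff_root_pos_iff b hJ]
        tauto
    rw [h3, rhoCheck, ← Finset.filter_filter, Finset.card_filter, Nat.cast_sum, ← mul_assoc,
      mul_one_div_cancel two_ne_zero, one_mul, sub_eq_add_neg, ← Finset.sum_neg_distrib]
    congr 1
    refine Finset.sum_congr rfl fun i hi => ?_
    rw [Finset.mem_filter] at hi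
    rcases h2 i hi.2.1 hi.2.2 with ⟨h4, h5⟩ | ⟨h4, h5⟩ <;> simp [h4, h5]
  rw [h1]
  ring

end Peterson

/-! ### Comparison of edges -/

section Edges

variable [P.IsRootSystem] [P.IsCrystallographic] [P.IsReduced]

omit [P.IsRootSystem] in
theorem s_mem_W (i : ι) : s P (i, 0) ∈ W b := by
  have key : ∀ i j, s P (P.reflectionPerm j i, 0) = s P (j, 0) * s P (i, 0) * (s P (j, 0))⁻¹ :=
    fun i j => by rw [eq_mul_inv_iff_mul_eq, (realizes_s j).mul_s]
  refine b.induction_reflect i (p := fun i => s P (i, 0) ∈ W b) (fun i hi => ?_) (fun i hi => ?_)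
    (fun i j hi hj => ?_)
  · rw [key]
    exact mul_mem (mul_mem hi hi) (inv_mem hi)
  · exact Subgroup.subset_closure ⟨i, hi, rfl⟩
  · have hj' : s P (j, 0) ∈ W b := Subgroup.subset_closure ⟨j, hj, rfl⟩
    rw [key]
    exact mul_mem (mul_mem hj' hi) (inv_mem hj')

omit [P.IsReduced] in
/-- Elements of `(W^J)_af` may be multiplied on the right by elements of `(W^J)_af` with finite
part in `W_J`. -/
theorem mul_mem_peterson {J : Set ι} (hJ : J ⊆ b.support) {x y : (M × ℝ) ≃ₗ[ℝ] (M × ℝ)} {ξ : M}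
    (hx : x ∈ peterson b J) (hy : y ∈ parabolic P J) (hξ : ξ ∈ rootLattice P)
    (h : y * t P ξ ∈ peterson b J) : x * (y * t P ξ) ∈ peterson b J := by
  refine ⟨mul_mem hx.1 h.1, fun β hβ hβJ => ?_⟩
  obtain ⟨σ, hσ, hσJ⟩ := exists_realizes_of_mem_parabolic b hJ hy
  obtain ⟨β', hβ', e⟩ := h.2 β hβ hβJ
  obtain ⟨k, hk⟩ := exists_int_coroot hξ β.1
  have e' := e
  rw [show β = (β.1, β.2) from rfl, hσ.mul_t_affRoot hk] at e'
  have hJ' : InLevi P J β'.1 := by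
    rw [← affRoot_injective e', ← heightOff_root_eq_zero_iff b hJ, hσJ,
      heightOff_root_eq_zero_iff b hJ]
    exact hβJ
  rw [LinearEquiv.mul_apply, e]
  exact hx.2 β' hβ' hJ'

/-- The condition on lengths common to edges of both graphs, with `n = 0` for Bruhat edges and
`n = 1` for quantum edges. -/
def EdgeCondition (J : Set ι) (w : (M × ℝ) ≃ₗ[ℝ] (M × ℝ)) (γ : ι) (n : ℤ) : Prop :=
  (length b (floor b J (w * s P (γ, 0))) : ℝ) +
    n * (2 * (rhoCheck b b.support (P.root γ) - rhoCheck b J (P.root γ))) = length b w + 1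

/-- Both endpoints have the form u t_η with u ∈ W, so their lengths can be computed off J, where z_ξ
has no effect and the terms in ξ cancel. -/
theorem siEdge_iff [Nonempty ι] {J : Set ι} (hJ : J ⊆ b.support)
    {w : (M × ℝ) ≃ₗ[ℝ] (M × ℝ)} {π : Equiv.Perm ι} (hw : w ∈ minReps b J)
    (hπ : Realizes P w π) {ξ : M} (hξ : ξ ∈ adjusted b J) (γ : ι) (n : ℤ) :
    SiEdge b J (w * z b J ξ * t P ξ) (π γ, n) (s P (π γ, n) * (w * z b J ξ * t P ξ)) ↔
      AffPos b (π γ, n) ∧ s P (π γ, n) * (w * z b J ξ * t P ξ) ∈ peterson b J ∧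
        EdgeCondition b J w γ n := by
  classical
  obtain ⟨hz, hzt⟩ := z_spec b hJ hξ
  obtain ⟨σ, hσ, hσJ⟩ := exists_realizes_of_mem_parabolic b hJ hz
  have hzW := parabolic_le_W b hJ hz
  -- γ' = z_ξ⁻¹γ appears when t_{nγ} is moved to the right past z_ξ.
  set γ' := σ.symm γ with hγ'
  have hσγ : σ γ' = γ := σ.apply_symm_apply γ
  have hw0 : w * t P (0 : M) ∈ peterson b J :=
    (mem_peterson_iff b hw.1 hπ (zero_mem _)).2 fun i hi hiJ =>
      .inl ⟨by simp, isPos_of_mem_minReps b hJ hw hπ hi hiJ⟩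
  have hx : w * z b J ξ * t P ξ ∈ peterson b J := by
    rw [mul_assoc]
    refine mul_mem_peterson b hJ ?_ hz hξ.1 hzt
    simpa [t_zero] using hw0
  have hη : (n : ℝ) • P.root γ' + ξ ∈ rootLattice P := by
    refine add_mem ?_ hξ.1
    rw [Int.cast_smul_eq_zsmul]
    exact Submodule.smul_mem _ _ (Submodule.subset_span ⟨_, rfl⟩)
  have hy : s P (π γ, n) * (w * z b J ξ * t P ξ) =
      (w * s P (γ, 0) * z b J ξ) * t P ((n : ℝ) • P.root γ' + ξ) := by
    have h1 := hσ.mul_t_smul_root γ' n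
    rw [hσγ] at h1
    rw [t_add, mul_assoc w, ← mul_assoc (s P (π γ, n)), ← hπ.mul_s, s_eq_mul_t P γ n]
    simp only [mul_assoc]
    rw [← mul_assoc (z b J ξ) (t P _), h1]
    simp only [mul_assoc]
  have hlen : s P (π γ, n) * (w * z b J ξ * t P ξ) ∈ peterson b J →
      (siLength b (s P (π γ, n) * (w * z b J ξ * t P ξ)) =
        siLength b (w * z b J ξ * t P ξ) + 1 ↔ EdgeCondition b J w γ n) := by
    intro hmem
    rw [hy] at hmem ⊢
    have hws := mul_mem hw.1 (s_mem_W b γ)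
    rw [siLength_of_mem_peterson b hJ (mul_mem hws hzW) ((hπ.mul (realizes_s γ)).mul hσ) hη hmem,
      siLength_of_mem_peterson b hJ (mul_mem hw.1 hzW) (hπ.mul hσ) hξ.1 hx,
      invCount_mul b _ hσJ, invCount_mul b _ hσJ, EdgeCondition,
      length_floor b hJ hws (hπ.mul (realizes_s γ)), length_of_mem_minReps b hJ hw hπ,
      two_mul_rhoCheck_sub b hJ]
    -- The sum of the coroots of Δ⁺ ∖ Δ_J⁺ is W_J-invariant, so γ' may be replaced by γ.
    have hR : ∑ i with 0 < heightOff b J (P.root i), P.coroot' i (P.root γ') =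
        ∑ i with 0 < heightOff b J (P.root i), P.coroot' i (P.root γ) := by
      rw [Finset.sum_filter, Finset.sum_filter, ← Equiv.sum_comp σ fun i =>
        if 0 < heightOff b J (P.root i) then P.coroot' i (P.root γ) else 0]
      refine Finset.sum_congr rfl fun i _ => ?_
      have := hσ.coroot_map i (P.root γ', 0)
      rw [hσ.map_root, hσγ] at this
      simp only [hσJ, this]
    simp only [map_add, map_smul, smul_eq_mul, Finset.sum_add_distrib, ← Finset.mul_sum, hR]
    constructor <;> intro h <;> linarith
  constructor
  · intro h
    exact ⟨h.pos, h.target_mem, (hlen h.target_mem).1 h.siLength_eq⟩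
  · rintro ⟨h1, h2, h3⟩
    exact ⟨hx, h2, h1, rfl, (hlen h2).2 h3⟩

theorem siEdge_of_edgeCondition [Nonempty ι] {J : Set ι} (hJ : J ⊆ b.support)
    {w : (M × ℝ) ≃ₗ[ℝ] (M × ℝ)} {π : Equiv.Perm ι} (hw : w ∈ minReps b J)
    (hπ : Realizes P w π) {γ : ι} (hγ : b.IsPos γ) (hγJ : ¬ InLevi P J γ) {n : ℤ}
    (hn : n = 0 ∨ n = 1) (h : EdgeCondition b J w γ n) :
    AffPos b (π γ, n) ∧ ∀ ξ ∈ adjusted b J,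
      SiEdge b J (w * z b J ξ * t P ξ) (π γ, n) (s P (π γ, n) * (w * z b J ξ * t P ξ)) := by
  classical
  have hws := mul_mem hw.1 (s_mem_W b γ)
  have hr := hπ.mul (realizes_s γ)
  have hcond := h
  rw [EdgeCondition, length_floor b hJ hws hr, length_of_mem_minReps b hJ hw hπ,
    two_mul_rhoCheck_sub b hJ] at h
  obtain ⟨h1, h2⟩ := isPos_and_pairing_of_invCount_eq b
    ((heightOff_root_pos_iff b hJ γ).2 ⟨hγ, hγJ⟩) hπ hn (by simpa using h)
  have hpos : AffPos b (π γ, n) := by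
    rcases hn with rfl | rfl
    · exact .inr ⟨rfl, h1 rfl⟩
    · exact .inl one_pos
  refine ⟨hpos, fun ξ hξ => (siEdge_iff b hJ hw hπ hξ γ n).2 ⟨hpos, ?_, hcond⟩⟩
  obtain ⟨hz, hzt⟩ := z_spec b hJ hξ
  -- The case ξ = 0 carries all the content; a general J-adjusted ξ follows by multiplying on the
  -- right by z_ξ t_ξ.
  have hmem : (w * s P (γ, 0)) * t P ((n : ℝ) • P.root γ) ∈ peterson b J := by
    refine (mem_peterson_iff b hws hr ?_).2 fun i hi hiJ => ?_
    · rw [Int.cast_smul_eq_zsmul]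
      exact Submodule.smul_mem _ _ (Submodule.subset_span ⟨_, rfl⟩)
    · have := h2 i ((heightOff_root_eq_zero_iff b hJ i).2 hiJ)
        (isPos_of_mem_minReps b hJ hw hπ hi hiJ)
      simpa using this
  have := mul_mem_peterson b hJ hmem hz hξ.1 hzt
  rwa [mul_assoc w (s P (γ, 0)), ← s_eq_mul_t, hπ.mul_s, mul_assoc, ← mul_assoc w] at this

omit [P.IsRootSystem] in
theorem qbgEdgeData {J : Set ι} (hJ : J ⊆ b.support) {w : (M × ℝ) ≃ₗ[ℝ] (M × ℝ)}
    (hw : w ∈ minReps b J) {γ : ι} (hγ : b.IsPos γ) (hγJ : ¬ InLevi P J γ) :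
    QBGEdgeData b J w γ (floor b J (w * s P (γ, 0))) :=
  ⟨hw, floor_mem_minReps b hJ (mul_mem hw.1 (s_mem_W b γ)), hγ, hγJ, rfl⟩

omit [P.IsRootSystem] in
theorem bruhatEdge_iff {J : Set ι} (hJ : J ⊆ b.support) {w : (M × ℝ) ≃ₗ[ℝ] (M × ℝ)}
    (hw : w ∈ minReps b J) {γ : ι} (hγ : b.IsPos γ) (hγJ : ¬ InLevi P J γ) :
    BruhatEdge b J w γ (floor b J (w * s P (γ, 0))) ↔ EdgeCondition b J w γ 0 := by
  rw [EdgeCondition, Int.cast_zero, zero_mul, add_zero]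
  exact ⟨fun h => by exact_mod_cast h.length_eq,
    fun h => ⟨qbgEdgeData b hJ hw hγ hγJ, by exact_mod_cast h⟩⟩

omit [P.IsRootSystem] in
theorem quantumEdge_iff {J : Set ι} (hJ : J ⊆ b.support) {w : (M × ℝ) ≃ₗ[ℝ] (M × ℝ)}
    (hw : w ∈ minReps b J) {γ : ι} (hγ : b.IsPos γ) (hγJ : ¬ InLevi P J γ) :
    QuantumEdge b J w γ (floor b J (w * s P (γ, 0))) ↔ EdgeCondition b J w γ 1 := by
  rw [EdgeCondition, Int.cast_one, one_mul]
  exact ⟨fun h => by have := h.length_eq; linarith,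
    fun h => ⟨qbgEdgeData b hJ hw hγ hγJ, by linarith⟩⟩

omit [P.IsRootSystem] [P.IsCrystallographic] [P.IsReduced] in
theorem Realizes.map_affRoot_add_delta {w : (M × ℝ) ≃ₗ[ℝ] (M × ℝ)} {π : Equiv.Perm ι}
    (hπ : Realizes P w π) (γ : ι) :
    w (affRoot P (γ, 0)) + c P γ • delta = affRoot P (π γ, 1) := by
  rw [hπ.map_affRoot]
  simp [affRoot, delta, hπ.c_perm]

end Edges

end DualUntwisted

theorem mainTheorem1 {ι M N : Type*} [Fintype ι] [AddCommGroup M] [Module ℝ M]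
    [AddCommGroup N] [Module ℝ N] (P : RootPairing ι ℝ M N)
    [P.IsCrystallographic] [P.IsReduced] [P.IsIrreducible]
    (hP : ∃ i j, P.RootForm (P.root i) (P.root i) ≠ P.RootForm (P.root j) (P.root j))
    (b : P.Base) (J : Set ι) (hJ : J ⊆ b.support) :
    (∀ w ∈ DualUntwisted.minReps b J, ∀ ξ ∈ DualUntwisted.adjusted b J,
      ∀ γ : ι, b.IsPos γ → ¬ DualUntwisted.InLevi P J γ → ∀ β : ι × ℤ,
        DualUntwisted.SiEdge b J
          (w * DualUntwisted.z b J ξ * DualUntwisted.t P ξ) β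
          (DualUntwisted.s P β * (w * DualUntwisted.z b J ξ * DualUntwisted.t P ξ)) →
        (DualUntwisted.affRoot P β = w (DualUntwisted.affRoot P (γ, 0)) →
          DualUntwisted.BruhatEdge b J w γ
            (DualUntwisted.floor b J (w * DualUntwisted.s P (γ, 0)))) ∧
        (DualUntwisted.affRoot P β =
            w (DualUntwisted.affRoot P (γ, 0)) + DualUntwisted.c P γ • DualUntwisted.delta →
          DualUntwisted.QuantumEdge b J w γ
            (DualUntwisted.floor b J (w * DualUntwisted.s P (γ, 0))))) ∧
    (∀ w ∈ DualUntwisted.minReps b J,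
      ∀ γ : ι, b.IsPos γ → ¬ DualUntwisted.InLevi P J γ →
        (DualUntwisted.BruhatEdge b J w γ
            (DualUntwisted.floor b J (w * DualUntwisted.s P (γ, 0))) →
          ∃ β : ι × ℤ, DualUntwisted.AffPos b β ∧
            DualUntwisted.affRoot P β = w (DualUntwisted.affRoot P (γ, 0)) ∧
            ∀ ξ ∈ DualUntwisted.adjusted b J,
              DualUntwisted.SiEdge b J
                (w * DualUntwisted.z b J ξ * DualUntwisted.t P ξ) β
                (DualUntwisted.s P β *
                  (w * DualUntwisted.z b J ξ * DualUntwisted.t P ξ))) ∧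
        (DualUntwisted.QuantumEdge b J w γ
            (DualUntwisted.floor b J (w * DualUntwisted.s P (γ, 0))) →
          ∃ β : ι × ℤ, DualUntwisted.AffPos b β ∧
            DualUntwisted.affRoot P β =
              w (DualUntwisted.affRoot P (γ, 0)) + DualUntwisted.c P γ • DualUntwisted.delta ∧
            ∀ ξ ∈ DualUntwisted.adjusted b J,
              DualUntwisted.SiEdge b J
                (w * DualUntwisted.z b J ξ * DualUntwisted.t P ξ) β
                (DualUntwisted.s P β *
                  (w * DualUntwisted.z b J ξ * DualUntwisted.t P ξ)))) := by
  have : Nonempty ι := ⟨hP.choose⟩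
  have : P.IsRootSystem := inferInstance
  open DualUntwisted in
  refine ⟨fun w hw ξ hξ γ hγ hγJ β hβ => ?_, fun w hw γ hγ hγJ => ?_⟩
  · obtain ⟨π, hπ⟩ := exists_realizes hw.1
    constructor
    · intro h
      rw [hπ.map_affRoot] at h
      obtain rfl := affRoot_injective h
      exact (bruhatEdge_iff b hJ hw hγ hγJ).2 ((siEdge_iff b hJ hw hπ hξ γ 0).1 hβ).2.2
    · intro h
      rw [hπ.map_affRoot_add_delta] at h
      obtain rfl := affRoot_injective h
      exact (quantumEdge_iff b hJ hw hγ hγJ).2 ((siEdge_iff b hJ hw hπ hξ γ 1).1 hβ).2.2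
  · obtain ⟨π, hπ⟩ := exists_realizes hw.1
    constructor
    · intro h
      obtain ⟨h1, h2⟩ := siEdge_of_edgeCondition b hJ hw hπ hγ hγJ (.inl rfl)
        ((bruhatEdge_iff b hJ hw hγ hγJ).1 h)
      exact ⟨_, h1, (hπ.map_affRoot γ 0).symm, h2⟩
    · intro h
      obtain ⟨h1, h2⟩ := siEdge_of_edgeCondition b hJ hw hπ hγ hγJ (.inr rfl)
        ((quantumEdge_iff b hJ hw hγ hγJ).1 h)
      exact ⟨_, h1, (hπ.map_affRoot_add_delta γ).symm, h2⟩
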